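/- Let $G$ be a finite connected simple graph (no loops, no multiple edges) with vertices $\mathsf v_1,\dots,\mathsf v_n$ and edges $\mathsf e_1,\dots,\mathsf e_m$, every vertex having degree at least $2$, each edge being parameterized on $[0,1]$. Let $c_j\in H^1(0,1)$ be real-valued with $c_j>0$ on $[0,1]$, and let $\mu_j>0$ be constants, $j=1,\dots,m$. Let $\Phi^\pm=(\phi^\pm_{ij})$ be the $n\times m$ matrices with $\phi^+_{ij}=1$ if $\mathsf e_j(0)=\mathsf v_i$ and $0$ otherwise, $\phi^-_{ij}=1$ if $\mathsf e_j(1)=\mathsf v_i$ and $0$ otherwise, and let $\Phi^\pm_w=(\omega^\pm_{ij})$ with $\omega^+_{ij}=\mu_jc_j(0)\phi^+_{ij}$ and $\omega^-_{ij}=\mu_jc_j(1)\phi^-_{ij}$. On the complex Hilbert space $X_2=\prod_{j=1}^m L^2(0,1;\mu_j\,dx)$ with $(f,g)_{X_2}=\sum_j\int_0^1 f_j\overline{g_j}\,\mu_j\,dx$ define $$V=\{f\in (H^1(0,1))^m:\ \exists d\in\mathbb C^n,\ (\Phi^+)^\top d=f(0),\ (\Phi^-)^\top d=f(1)\},\qquad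 \mathfrak a(f,g)=\sum_{j=1}^m\int_0^1\mu_jc_jf_j'\overline{g_j'}\,dx\quad(f,g\in V),$$ and the operator $$Af=\big((c_jf_j')'\big)_{j=1}^m,\qquad D(A)=\{f\in V\cap (H^2(0,1))^m:\ \Phi_w^+f'(0)=\Phi_w^-f'(1)\}.$$ Equip $V$ with the norm $\|f\|_V^2=\sum_j\int_0^1(|f_j'|^2+|f_j|^2)\mu_j\,dx$. Then: 1. $\mathfrak a$ is a densely defined, symmetric, positive ($\mathfrak a(f,f)\ge 0$), closed and continuous sesquilinear form on $X_2$ (closed: $V$ is complete for the form norm $\|f\|_{\mathfrak a}=\sqrt{\mathfrak a(f,f)+\|f\|_{X_2}^2}$; continuous: $|\mathfrak a(f,g)|\le M\|f\|_{\mathfrak a}\|g\|_{\mathfrak a}$ for some $M>0$), and the form norm is equivalent to $\|\cdot\|_V$. 2. $A$ is the operator associated with $\mathfrak a$: for $f,g\in X_2$, one has $f\in D(A)$ and $Af=-g$ if and only if $f\in V$ and $\mathfrak a(f,h)=(g,h)_{X_2}$ for all $h\in V$. 3. $A$ is self-adjoint and dissipative on $X_2$. 4. $A$ generates a cosine operator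 function with associated phase space $V\times X_2$. That is, there is a strongly continuous family $(C(t))_{t\in\mathbb R}$ of bounded operators on $X_2$ with $C(0)=I$ and $C(t+s)+C(t-s)=2C(t)C(s)$ for all $t,s\in\mathbb R$, such that $f\in D(A)$ and $Af=g$ if and only if $2t^{-2}(C(t)f-f)\to g$ in $X_2$ as $t\to0$; and $V$ is a Banach space with continuous inclusions $D(A)\hookrightarrow V\hookrightarrow X_2$ ($D(A)$ with the graph norm) such that the operator matrix $\begin{pmatrix}0&I\\A&0\end{pmatrix}$ with domain $D(A)\times V$ generates a strongly continuous group on $V\times X_2$. -/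

import Mathlib

open MeasureTheory Set Filter Topology
open scoped ContDiff ComplexConjugate Matrix

noncomputable section

namespace KirchhoffNetwork

/-! ### Weak derivatives on the open unit interval -/

/-- Test functions on `(0,1)`: smooth functions with compact support contained in `(0,1)`. -/
def IsTestFunction (φ : ℝ → ℝ) : Prop :=
  ContDiff ℝ ∞ φ ∧ HasCompactSupport φ ∧ tsupport φ ⊆ Ioo (0 : ℝ) 1

/-- `g` is a weak derivative of `f` on `(0,1)`: `∫ φ' f = - ∫ φ g` for all test functions `φ`.
It is only used for integrable `f` and `g`. -/
def HasWeakDeriv {E : Type*} [NormedAddCommGroup E] [NormedSpace ℝ E] (f g : ℝ → E) : Prop :=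
  ∀ φ : ℝ → ℝ, IsTestFunction φ →
    ∫ x in Ioo (0 : ℝ) 1, deriv φ x • f x = - ∫ x in Ioo (0 : ℝ) 1, φ x • g x

/-- `F` is a representative of the class of `f` on `(0,1)` that is continuous on `[0,1]`. -/
def IsContRep (F f : ℝ → ℂ) : Prop :=
  ContinuousOn F (Icc 0 1) ∧ f =ᵐ[volume.restrict (Ioo (0 : ℝ) 1)] F

section WeakDerivFacts

variable {E : Type*} [NormedAddCommGroup E] [NormedSpace ℝ E]

theorem IsTestFunction.integrable_smul {φ : ℝ → ℝ} (hφ : IsTestFunction φ) {f : ℝ → E}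
    (hf : IntegrableOn f (Ioo 0 1)) : IntegrableOn (fun x => φ x • f x) (Ioo 0 1) := by
  obtain ⟨C, hC⟩ := hφ.2.1.exists_bound_of_continuous hφ.1.continuous
  exact hf.bdd_smul C hφ.1.continuous.aestronglyMeasurable (ae_of_all _ hC)

theorem IsTestFunction.deriv {φ : ℝ → ℝ} (hφ : IsTestFunction φ) :
    IsTestFunction (deriv φ) :=
  ⟨(contDiff_infty_iff_deriv.1 hφ.1).2, hφ.2.1.deriv,
    (closure_minimal (support_deriv_subset (f := φ)) (isClosed_tsupport φ)).trans hφ.2.2⟩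

theorem HasWeakDeriv.congr {f f₁ g g₁ : ℝ → E} (h : HasWeakDeriv f g)
    (hf : f =ᵐ[volume.restrict (Ioo (0 : ℝ) 1)] f₁)
    (hg : g =ᵐ[volume.restrict (Ioo (0 : ℝ) 1)] g₁) : HasWeakDeriv f₁ g₁ := by
  intro φ hφ
  have e₁ : ∫ x in Ioo (0 : ℝ) 1, _root_.deriv φ x • f₁ x
      = ∫ x in Ioo (0 : ℝ) 1, _root_.deriv φ x • f x :=
    integral_congr_ae (by filter_upwards [hf] with x hx; rw [hx])
  have e₂ : ∫ x in Ioo (0 : ℝ) 1, φ x • g₁ x = ∫ x in Ioo (0 : ℝ) 1, φ x • g x :=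
    integral_congr_ae (by filter_upwards [hg] with x hx; rw [hx])
  rw [e₁, e₂, h φ hφ]

theorem HasWeakDeriv.add {f f₁ g g₁ : ℝ → E} (h : HasWeakDeriv f g) (h₁ : HasWeakDeriv f₁ g₁)
    (hf : IntegrableOn f (Ioo 0 1)) (hg : IntegrableOn g (Ioo 0 1))
    (hf₁ : IntegrableOn f₁ (Ioo 0 1)) (hg₁ : IntegrableOn g₁ (Ioo 0 1)) :
    HasWeakDeriv (fun x => f x + f₁ x) (fun x => g x + g₁ x) := by
  intro φ hφ
  simp only [smul_add]
  rw [integral_add (hφ.deriv.integrable_smul hf) (hφ.deriv.integrable_smul hf₁),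
    integral_add (hφ.integrable_smul hg) (hφ.integrable_smul hg₁), h φ hφ, h₁ φ hφ, neg_add]

theorem HasWeakDeriv.clm {E₁ : Type*} [NormedAddCommGroup E₁] [NormedSpace ℝ E₁]
    [CompleteSpace E] [CompleteSpace E₁]
    {f g : ℝ → E} (h : HasWeakDeriv f g) (hf : IntegrableOn f (Ioo 0 1))
    (hg : IntegrableOn g (Ioo 0 1)) (L : E →L[ℝ] E₁) :
    HasWeakDeriv (fun x => L (f x)) (fun x => L (g x)) := by
  intro φ hφ
  have e := congrArg L (h φ hφ)
  rw [map_neg, ← L.integral_comp_comm (hφ.deriv.integrable_smul hf),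
    ← L.integral_comp_comm (hφ.integrable_smul hg)] at e
  simpa only [map_smul] using e

theorem HasWeakDeriv.const_mul {f g : ℝ → ℂ} (h : HasWeakDeriv f g) (a : ℂ) :
    HasWeakDeriv (fun x => a * f x) (fun x => a * g x) := by
  intro φ hφ
  have e₁ : ∀ x, _root_.deriv φ x • (a * f x) = a * (_root_.deriv φ x • f x) := fun x => by
    rw [mul_smul_comm]
  have e₂ : ∀ x, φ x • (a * g x) = a * (φ x • g x) := fun x => by rw [mul_smul_comm]
  simp only [e₁, e₂]
  rw [integral_const_mul, integral_const_mul, h φ hφ, mul_neg]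

theorem hasWeakDeriv_zero : HasWeakDeriv (fun _ => (0 : E)) (fun _ => 0) := by
  intro φ hφ; simp

/-- Fundamental lemma of the calculus of variations on `(0,1)`. -/
theorem ae_eq_zero_of_test [CompleteSpace E] {f : ℝ → E} (hf : IntegrableOn f (Ioo 0 1))
    (h : ∀ φ : ℝ → ℝ, IsTestFunction φ → ∫ x in Ioo (0 : ℝ) 1, φ x • f x = 0) :
    f =ᵐ[volume.restrict (Ioo (0 : ℝ) 1)] 0 := by
  rw [Filter.EventuallyEq, ae_restrict_iff' measurableSet_Ioo]
  refine isOpen_Ioo.ae_eq_zero_of_integral_contDiff_smul_eq_zero hf.locallyIntegrableOn ?_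
  intro φ h1 h2 h3
  rw [← h φ ⟨h1, h2, h3⟩, setIntegral_eq_integral_of_forall_compl_eq_zero]
  intro x hx
  rw [image_eq_zero_of_notMem_tsupport (fun hx' => hx (h3 hx')), zero_smul]

theorem HasWeakDeriv.unique [CompleteSpace E] {f g g₁ : ℝ → E} (h : HasWeakDeriv f g)
    (h₁ : HasWeakDeriv f g₁) (hg : IntegrableOn g (Ioo 0 1)) (hg₁ : IntegrableOn g₁ (Ioo 0 1)) :
    g =ᵐ[volume.restrict (Ioo (0 : ℝ) 1)] g₁ := by
  have := ae_eq_zero_of_test (hg.sub hg₁) (fun φ hφ => by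
    simp only [Pi.sub_apply, smul_sub]
    rw [integral_sub (hφ.integrable_smul hg) (hφ.integrable_smul hg₁), sub_eq_zero,
      ← neg_inj, ← h φ hφ, ← h₁ φ hφ])
  filter_upwards [this] with x hx
  simpa [sub_eq_zero] using hx

/-- A test function of integral zero is the derivative of a test function. -/
theorem IsTestFunction.exists_primitive {χ : ℝ → ℝ} (hχ : IsTestFunction χ)
    (h0 : ∫ x in Ioo (0 : ℝ) 1, χ x = 0) : ∃ φ, IsTestFunction φ ∧ _root_.deriv φ = χ := by
  have hcont := hχ.1.continuous
  have hz : ∀ x, x ∉ Ioo (0 : ℝ) 1 → χ x = 0 := fun x hx =>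
    image_eq_zero_of_notMem_tsupport fun h => hx (hχ.2.2 h)
  have hd : ∀ x, HasDerivAt (fun y => ∫ t in (0 : ℝ)..y, χ t) (χ x) x := fun x =>
    intervalIntegral.integral_hasDerivAt_right (hcont.intervalIntegrable _ _)
      (hcont.stronglyMeasurableAtFilter _ _) hcont.continuousAt
  have hderiv : _root_.deriv (fun y => ∫ t in (0 : ℝ)..y, χ t) = χ := funext fun x => (hd x).deriv
  -- the support of `χ` lies in a smaller closed interval
  obtain ⟨a, b, ha, hab, hb, hs⟩ : ∃ a b : ℝ, 0 < a ∧ a ≤ b ∧ b < 1 ∧ tsupport χ ⊆ Icc a b := by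
    rcases (tsupport χ).eq_empty_or_nonempty with he | hne
    · exact ⟨1/2, 1/2, by norm_num, le_rfl, by norm_num, by simp [he]⟩
    · have hc : IsCompact (tsupport χ) := hχ.2.1
      refine ⟨sInf (tsupport χ), sSup (tsupport χ), (hχ.2.2 (hc.sInf_mem hne)).1, ?_,
        (hχ.2.2 (hc.sSup_mem hne)).2, fun x hx => ⟨csInf_le hc.bddBelow hx, le_csSup hc.bddAbove hx⟩⟩
      exact csInf_le hc.bddBelow (hc.sSup_mem hne)
  have hz2 : ∀ x, x ∉ Icc a b → χ x = 0 := fun x hx =>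
    image_eq_zero_of_notMem_tsupport fun h => hx (hs h)
  have hint1 : ∫ t in (0 : ℝ)..1, χ t = 0 := by
    rw [intervalIntegral.integral_of_le zero_le_one, integral_Ioc_eq_integral_Ioo, h0]
  have hsupp : Function.support (fun y => ∫ t in (0 : ℝ)..y, χ t) ⊆ Icc a b := by
    intro y hy
    by_contra hyn
    apply hy
    rcases lt_or_ge y a with h | h
    · have : EqOn χ (fun _ => (0 : ℝ)) (uIcc 0 y) := fun t ht => hz2 t fun ht2 => by
        have := (le_max_iff.1 (ht.2 : t ≤ max 0 y))
        rcases this with h3 | h3 <;> linarith [ht2.1]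
      simp [intervalIntegral.integral_congr this]
    · have hby : b < y := lt_of_not_ge fun h2 => hyn ⟨h, h2⟩
      have : EqOn χ (fun _ => (0 : ℝ)) (uIcc 1 y) := fun t ht => hz2 t fun ht2 => by
        have := (min_le_iff.1 (ht.1 : min 1 y ≤ t))
        rcases this with h3 | h3 <;> linarith [ht2.2]
      have e := intervalIntegral.integral_add_adjacent_intervals
        (hcont.intervalIntegrable (μ := volume) 0 1) (hcont.intervalIntegrable 1 y)
      rw [hint1, intervalIntegral.integral_congr this] at e
      simpa using e.symm
  have hts : tsupport (fun y => ∫ t in (0 : ℝ)..y, χ t) ⊆ Icc a b :=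
    closure_minimal hsupp isClosed_Icc
  refine ⟨fun y => ∫ t in (0 : ℝ)..y, χ t, ⟨?_, ?_, ?_⟩, hderiv⟩
  · rw [contDiff_infty_iff_deriv, hderiv]
    exact ⟨fun x => (hd x).differentiableAt, hχ.1⟩
  · exact HasCompactSupport.of_support_subset_isCompact isCompact_Icc hsupp
  · exact hts.trans fun x hx => ⟨ha.trans_le hx.1, hx.2.trans_lt hb⟩

theorem exists_testFunction_integral_one :
    ∃ ψ, IsTestFunction ψ ∧ ∫ x in Ioo (0 : ℝ) 1, ψ x = 1 := by
  let B : ContDiffBump (1 / 2 : ℝ) := ⟨1 / 8, 1 / 4, by norm_num, by norm_num⟩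
  have hts : tsupport (B.normed volume) ⊆ Ioo (0 : ℝ) 1 := by
    rw [B.tsupport_normed_eq, Real.closedBall_eq_Icc]
    intro x hx
    have h1 : (1 / 2 : ℝ) - 1 / 4 ≤ x := hx.1
    have h2 : x ≤ (1 / 2 : ℝ) + 1 / 4 := hx.2
    constructor <;> linarith
  refine ⟨B.normed volume, ⟨B.contDiff_normed, B.hasCompactSupport_normed, hts⟩, ?_⟩
  rw [setIntegral_eq_integral_of_forall_compl_eq_zero, B.integral_normed]
  intro x hx
  exact image_eq_zero_of_notMem_tsupport (fun hx' => hx (hts hx'))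

/-- A function with zero weak derivative is constant. -/
theorem HasWeakDeriv.const_of_zero {f : ℝ → ℝ} (hf : IntegrableOn f (Ioo 0 1))
    (h : HasWeakDeriv f (fun _ => 0)) :
    ∃ C : ℝ, f =ᵐ[volume.restrict (Ioo (0 : ℝ) 1)] fun _ => C := by
  obtain ⟨ψ, hψ, hψ1⟩ := exists_testFunction_integral_one
  have hone : IntegrableOn (fun _ : ℝ => (1 : ℝ)) (Ioo 0 1) := by simp
  refine ⟨∫ x in Ioo (0 : ℝ) 1, ψ x * f x, ?_⟩
  set C := ∫ x in Ioo (0 : ℝ) 1, ψ x * f x with hC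
  have hCi : IntegrableOn (fun _ : ℝ => C) (Ioo 0 1) := by simp
  have key := ae_eq_zero_of_test (hf.sub hCi) (fun φ hφ => by
    have hφi : IntegrableOn φ (Ioo 0 1) := by simpa using hφ.integrable_smul hone
    have hψi : IntegrableOn ψ (Ioo 0 1) := by simpa using hψ.integrable_smul hone
    set I := ∫ x in Ioo (0 : ℝ) 1, φ x with hI
    have hχ : IsTestFunction (fun x => φ x - I * ψ x) := by
      refine ⟨hφ.1.sub (contDiff_const.mul hψ.1), ?_, ?_⟩
      · exact hφ.2.1.sub (hψ.2.1.mul_left (f := fun _ => I))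
      · refine (tsupport_sub φ (fun x => I * ψ x)).trans (union_subset hφ.2.2 ?_)
        exact (tsupport_mul_subset_right (f := fun _ => I)).trans hψ.2.2
    obtain ⟨Φ, hΦ, hΦd⟩ := hχ.exists_primitive (by
      rw [integral_sub hφi (hψi.const_mul I), integral_const_mul, hψ1, mul_one, sub_self])
    have e := h Φ hΦ
    have hφf : IntegrableOn (fun x => φ x * f x) (Ioo 0 1) := hφ.integrable_smul hf
    have hψf : IntegrableOn (fun x => ψ x * f x) (Ioo 0 1) := hψ.integrable_smul hf
    simp only [hΦd, smul_eq_mul, mul_zero, integral_zero, neg_zero, sub_mul, mul_assoc] at e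
    rw [integral_sub hφf (hψf.const_mul I), integral_const_mul, ← hC] at e
    simp only [Pi.sub_apply, smul_eq_mul, mul_sub]
    rw [integral_sub hφf (hφi.mul_const C), integral_mul_const, ← hI]
    exact e)
  filter_upwards [key] with x hx
  simpa [sub_eq_zero] using hx

theorem hasWeakDeriv_of_ac {F a : ℝ → ℝ}
    (hF : AbsolutelyContinuousOnInterval F 0 1)
    (ha : ∀ᵐ x, x ∈ uIcc (0 : ℝ) 1 → HasDerivAt F (a x) x) : HasWeakDeriv F a := by
  intro φ hφ
  have hφac : AbsolutelyContinuousOnInterval φ 0 1 :=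
    ContDiffOn.absolutelyContinuousOnInterval (hφ.1.of_le (by simp)).contDiffOn
  have e := hF.integral_mul_deriv_eq_deriv_mul hφac
  have z0 : φ 0 = 0 := image_eq_zero_of_notMem_tsupport fun h => by simpa using hφ.2.2 h
  have z1 : φ 1 = 0 := image_eq_zero_of_notMem_tsupport fun h => by simpa using hφ.2.2 h
  rw [z0, z1, mul_zero, mul_zero, sub_zero, zero_sub,
    intervalIntegral.integral_of_le zero_le_one, intervalIntegral.integral_of_le zero_le_one,
    integral_Ioc_eq_integral_Ioo, integral_Ioc_eq_integral_Ioo] at e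
  simp only [smul_eq_mul]
  rw [show (∫ x in Ioo (0 : ℝ) 1, _root_.deriv φ x * F x)
    = ∫ x in Ioo (0 : ℝ) 1, F x * _root_.deriv φ x by simp only [mul_comm], e, neg_inj]
  refine integral_congr_ae ?_
  filter_upwards [ae_restrict_of_ae ha, ae_restrict_mem measurableSet_Ioo] with x hx hx2
  rw [(hx (by rw [uIcc_of_le zero_le_one]; exact Ioo_subset_Icc_self hx2)).deriv, mul_comm]

/-- An integrable function with integrable weak derivative has an absolutely continuous
representative. -/
theorem HasWeakDeriv.exists_ac {f g : ℝ → ℝ} (h : HasWeakDeriv f g)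
    (hf : IntegrableOn f (Ioo 0 1)) (hg : IntegrableOn g (Ioo 0 1)) :
    ∃ F : ℝ → ℝ, AbsolutelyContinuousOnInterval F 0 1 ∧
      (∀ᵐ x, x ∈ uIcc (0 : ℝ) 1 → HasDerivAt F (g x) x) ∧
      f =ᵐ[volume.restrict (Ioo (0 : ℝ) 1)] F := by
  have hgi : IntervalIntegrable g volume 0 1 := by
    rw [intervalIntegrable_iff_integrableOn_Ioo_of_le zero_le_one]; exact hg
  have hac := hgi.absolutelyContinuousOnInterval_intervalIntegral (c := 0) (by simp)
  have hd : ∀ᵐ x, x ∈ uIcc (0 : ℝ) 1 →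
      HasDerivAt (fun x => ∫ v in (0 : ℝ)..x, g v) (g x) x := by
    filter_upwards [hgi.ae_hasDerivAt_integral] with x hx hx2
    exact hx hx2 0 (by simp)
  have hGi : IntegrableOn (fun x => ∫ v in (0 : ℝ)..x, g v) (Ioo 0 1) := by
    have := hac.continuousOn
    rw [uIcc_of_le zero_le_one] at this
    exact (this.integrableOn_Icc).mono_set Ioo_subset_Icc_self
  have hw := hasWeakDeriv_of_ac hac hd
  have hw2 : HasWeakDeriv (fun x => f x - ∫ v in (0 : ℝ)..x, g v) (fun _ => 0) := by
    intro φ hφ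
    simp only [smul_sub]
    rw [integral_sub (hφ.deriv.integrable_smul hf) (hφ.deriv.integrable_smul hGi), h φ hφ, hw φ hφ]
    simp
  obtain ⟨C, hC⟩ := hw2.const_of_zero (hf.sub hGi)
  refine ⟨fun x => C + ∫ v in (0 : ℝ)..x, g v, ?_, ?_, ?_⟩
  · have hc : AbsolutelyContinuousOnInterval (fun _ : ℝ => C) 0 1 :=
      ContDiffOn.absolutelyContinuousOnInterval contDiffOn_const
    exact hc.add hac
  · filter_upwards [hd] with x hx hx2
    exact (hx hx2).const_add C
  · filter_upwards [hC] with x hx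
    have hx2 : f x - ∫ v in (0 : ℝ)..x, g v = C := hx
    linarith

/-- Product rule for weak derivatives, real-valued case. -/
theorem HasWeakDeriv.mul_real {c c₁ f g : ℝ → ℝ} (hc : HasWeakDeriv c c₁) (h : HasWeakDeriv f g)
    (hci : IntegrableOn c (Ioo 0 1)) (hc₁ : IntegrableOn c₁ (Ioo 0 1))
    (hf : IntegrableOn f (Ioo 0 1)) (hg : IntegrableOn g (Ioo 0 1)) :
    HasWeakDeriv (fun x => c x * f x) (fun x => c₁ x * f x + c x * g x) := by
  obtain ⟨K, hK, hKd, hKe⟩ := hc.exists_ac hci hc₁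
  obtain ⟨F, hF, hFd, hFe⟩ := h.exists_ac hf hg
  have := hasWeakDeriv_of_ac (F := fun x => K x * F x)
    (a := fun x => c₁ x * F x + K x * g x) (hK.fun_mul hF) (by
      filter_upwards [hKd, hFd] with x h1 h2 h3
      exact (h1 h3).mul (h2 h3))
  refine this.congr ?_ ?_
  · filter_upwards [hKe, hFe] with x h1 h2
    rw [h1, h2]
  · filter_upwards [hKe, hFe] with x h1 h2
    rw [h1, h2]

/-- An integrable complex function with integrable weak derivative has a continuous
representative on `[0,1]`. -/
theorem HasWeakDeriv.exists_isContRep {f g : ℝ → ℂ} (h : HasWeakDeriv f g)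
    (hf : IntegrableOn f (Ioo 0 1)) (hg : IntegrableOn g (Ioo 0 1)) : ∃ F, IsContRep F f := by
  obtain ⟨F, hF, -, hFe⟩ := (h.clm hf hg Complex.reCLM).exists_ac
    (Complex.reCLM.integrable_comp hf) (Complex.reCLM.integrable_comp hg)
  obtain ⟨G, hG, -, hGe⟩ := (h.clm hf hg Complex.imCLM).exists_ac
    (Complex.imCLM.integrable_comp hf) (Complex.imCLM.integrable_comp hg)
  have hF2 := hF.continuousOn
  have hG2 := hG.continuousOn
  rw [uIcc_of_le zero_le_one] at hF2 hG2
  refine ⟨fun x => (F x : ℂ) + (G x : ℂ) * Complex.I, ?_, ?_⟩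
  · exact (Complex.continuous_ofReal.comp_continuousOn hF2).add
      ((Complex.continuous_ofReal.comp_continuousOn hG2).mul continuousOn_const)
  · filter_upwards [hFe, hGe] with x h1 h2
    rw [← h1, ← h2]
    simp [Complex.re_add_im]

/-- Product rule for weak derivatives. -/
theorem HasWeakDeriv.ofReal_mul {c c₁ : ℝ → ℝ} {f g : ℝ → ℂ} (hc : HasWeakDeriv c c₁)
    (h : HasWeakDeriv f g)
    (hci : IntegrableOn c (Ioo 0 1)) (hc₁ : IntegrableOn c₁ (Ioo 0 1))
    (hf : IntegrableOn f (Ioo 0 1)) (hg : IntegrableOn g (Ioo 0 1))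
    (hcf : IntegrableOn (fun x => (c x : ℂ) * f x) (Ioo 0 1))
    (hp : IntegrableOn (fun x => (c₁ x : ℂ) * f x + (c x : ℂ) * g x) (Ioo 0 1)) :
    HasWeakDeriv (fun x => (c x : ℂ) * f x) (fun x => (c₁ x : ℂ) * f x + (c x : ℂ) * g x) := by
  have hre := hc.mul_real (h.clm hf hg Complex.reCLM) hci hc₁
    (Complex.reCLM.integrable_comp hf) (Complex.reCLM.integrable_comp hg)
  have him := hc.mul_real (h.clm hf hg Complex.imCLM) hci hc₁
    (Complex.imCLM.integrable_comp hf) (Complex.imCLM.integrable_comp hg)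
  intro φ hφ
  have i₁ := hφ.deriv.integrable_smul hcf
  have i₂ := hφ.integrable_smul hp
  apply Complex.ext
  · have e₁ := Complex.reCLM.integral_comp_comm i₁
    have e₂ := Complex.reCLM.integral_comp_comm i₂
    have := hre φ hφ
    simp only [Complex.reCLM_apply] at e₁ e₂ this
    rw [Complex.neg_re, ← e₁, ← e₂]
    simpa [mul_add] using this
  · have e₁ := Complex.imCLM.integral_comp_comm i₁
    have e₂ := Complex.imCLM.integral_comp_comm i₂
    have := him φ hφ
    simp only [Complex.imCLM_apply] at e₁ e₂ this
    rw [Complex.neg_im, ← e₁, ← e₂]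
    simpa [mul_add] using this

end WeakDerivFacts

/-! ### The network -/

/-- A finite connected simple graph with vertices `0, …, n-1` and edges `0, …, m-1`, all of whose
vertices have degree at least two, whose edges are parameterized on `[0,1]`, together with the
coefficients of the equation: weights `0 < c j ∈ H¹(0,1)`, given by their continuous
representatives on `[0,1]`, and constants `μ j > 0`. -/
structure Network (n m : ℕ) where
  /-- the vertex `e_j(0)` -/
  src : Fin m → Fin n
  /-- the vertex `e_j(1)` -/
  tgt : Fin m → Fin n
  /-- there are no loops -/
  src_ne_tgt : ∀ j, src j ≠ tgt j
  /-- there are no multiple edges -/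
  edge_injective : Function.Injective fun j => s(src j, tgt j)
  connected : (SimpleGraph.fromEdgeSet (Set.range fun j => s(src j, tgt j))).Connected
  two_le_degree : ∀ i, 2 ≤ (Finset.univ.filter fun j => src j = i ∨ tgt j = i).card
  c : Fin m → ℝ → ℝ
  c_continuousOn : ∀ j, ContinuousOn (c j) (Icc 0 1)
  c_pos : ∀ j, ∀ x ∈ Icc (0 : ℝ) 1, 0 < c j x
  c_memH1 : ∀ j, ∃ c' : ℝ → ℝ,
    MemLp c' 2 (volume.restrict (Ioo 0 1)) ∧ HasWeakDeriv (c j) c'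
  μ : Fin m → ℝ
  μ_pos : ∀ j, 0 < μ j

namespace Network

variable {n m : ℕ} (N : Network n m)

/-- The incidence matrix `Φ⁺`. -/
def incPlus : Matrix (Fin n) (Fin m) ℂ :=
  Matrix.of fun i j => if N.src j = i then 1 else 0

/-- The incidence matrix `Φ⁻`. -/
def incMinus : Matrix (Fin n) (Fin m) ℂ :=
  Matrix.of fun i j => if N.tgt j = i then 1 else 0

/-- The weighted incidence matrix `Φ_w⁺`. -/
def wincPlus : Matrix (Fin n) (Fin m) ℂ :=
  Matrix.of fun i j => if N.src j = i then ((N.μ j * N.c j 0 : ℝ) : ℂ) else 0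

/-- The weighted incidence matrix `Φ_w⁻`. -/
def wincMinus : Matrix (Fin n) (Fin m) ℂ :=
  Matrix.of fun i j => if N.tgt j = i then ((N.μ j * N.c j 1 : ℝ) : ℂ) else 0

/-- The measure `μ_j dx` on `(0,1)`. -/
def edgeMeasure (j : Fin m) : Measure ℝ :=
  ENNReal.ofReal (N.μ j) • volume.restrict (Ioo 0 1)

instance (j : Fin m) : IsFiniteMeasure (N.edgeMeasure j) := by
  exact Measure.smul_finite _ ENNReal.ofReal_ne_top

/-- The Hilbert space `X₂ = ∏_j L²(0,1; μ_j dx)`. -/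
abbrev X2 : Type := PiLp 2 fun j : Fin m => Lp ℂ 2 (N.edgeMeasure j)

theorem ofReal_μ_ne_zero (j : Fin m) : ENNReal.ofReal (N.μ j) ≠ 0 := by
  simpa using N.μ_pos j

theorem ae_edge {j : Fin m} {p : ℝ → Prop} (h : ∀ᵐ x ∂(N.edgeMeasure j), p x) :
    ∀ᵐ x ∂(volume.restrict (Ioo (0 : ℝ) 1)), p x :=
  (Measure.ae_ennreal_smul_measure_iff (N.ofReal_μ_ne_zero j)).1 h

theorem memLp_edge_iff {j : Fin m} {f : ℝ → ℂ} :
    MemLp f 2 (N.edgeMeasure j) ↔ MemLp f 2 (volume.restrict (Ioo (0 : ℝ) 1)) := by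
  constructor
  · intro h
    have h2 := h.smul_measure (c := (ENNReal.ofReal (N.μ j))⁻¹)
      (ENNReal.inv_ne_top.2 (N.ofReal_μ_ne_zero j))
    rwa [edgeMeasure, smul_smul, ENNReal.inv_mul_cancel (N.ofReal_μ_ne_zero j)
      ENNReal.ofReal_ne_top, one_smul] at h2
  · intro h
    exact h.smul_measure ENNReal.ofReal_ne_top

variable {N}

theorem memLp_X2 (f : N.X2) (j : Fin m) : MemLp (f j) 2 (volume.restrict (Ioo (0 : ℝ) 1)) :=
  N.memLp_edge_iff.1 (Lp.memLp (f j))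

theorem integrableOn_X2 (f : N.X2) (j : Fin m) : IntegrableOn (f j) (Ioo (0 : ℝ) 1) :=
  (memLp_X2 f j).integrable (by norm_num)

theorem coeFn_add_X2 (f g : N.X2) (j : Fin m) :
    ((f + g) j : ℝ → ℂ) =ᵐ[volume.restrict (Ioo (0 : ℝ) 1)] fun x => f j x + g j x :=
  N.ae_edge (Lp.coeFn_add (f j) (g j))

theorem coeFn_smul_X2 (a : ℂ) (f : N.X2) (j : Fin m) :
    ((a • f) j : ℝ → ℂ) =ᵐ[volume.restrict (Ioo (0 : ℝ) 1)] fun x => a * f j x :=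
  N.ae_edge (Lp.coeFn_smul a (f j))

theorem coeFn_zero_X2 (j : Fin m) :
    ((0 : N.X2) j : ℝ → ℂ) =ᵐ[volume.restrict (Ioo (0 : ℝ) 1)] fun _ => 0 :=
  N.ae_edge (Lp.coeFn_zero ℂ 2 (N.edgeMeasure j))

/-- `f'` is the weak derivative of `f`, edge by edge; thus `f ∈ (H¹(0,1))^m`. -/
def IsWeakDeriv (f f' : N.X2) : Prop := ∀ j, HasWeakDeriv (f j) (f' j)

/-- `f` is continuous at the vertices: there is `d ∈ ℂⁿ` with `(Φ⁺)ᵀ d = f(0)` and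
`(Φ⁻)ᵀ d = f(1)`. The boundary values are those of the continuous representatives. -/
def IsVertexContinuous (f : N.X2) : Prop :=
  ∃ F : Fin m → ℝ → ℂ, (∀ j, IsContRep (F j) (f j)) ∧
    ∃ d : Fin n → ℂ, (N.incPlus)ᵀ *ᵥ d = (fun j => F j 0) ∧ (N.incMinus)ᵀ *ᵥ d = (fun j => F j 1)

/-- The Kirchhoff law for `g = f'`: `Φ_w⁺ g(0) = Φ_w⁻ g(1)`. -/
def IsKirchhoff (g : N.X2) : Prop :=
  ∃ G : Fin m → ℝ → ℂ, (∀ j, IsContRep (G j) (g j)) ∧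
    N.wincPlus *ᵥ (fun j => G j 0) = N.wincMinus *ᵥ (fun j => G j 1)

theorem IsContRep_add {F G : ℝ → ℂ} {f g : N.X2} {j : Fin m} (hF : IsContRep F (f j))
    (hG : IsContRep G (g j)) : IsContRep (fun x => F x + G x) ((f + g) j) := by
  refine ⟨hF.1.add hG.1, ?_⟩
  filter_upwards [coeFn_add_X2 f g j, hF.2, hG.2] with x h1 h2 h3
  rw [h1, h2, h3]

theorem IsContRep_smul {F : ℝ → ℂ} {f : N.X2} {j : Fin m} (a : ℂ) (hF : IsContRep F (f j)) :
    IsContRep (fun x => a * F x) ((a • f) j) := by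
  refine ⟨continuousOn_const.mul hF.1, ?_⟩
  filter_upwards [coeFn_smul_X2 a f j, hF.2] with x h1 h2
  rw [h1, h2]

theorem IsContRep_zero {j : Fin m} : IsContRep (fun _ => 0) ((0 : N.X2) j) :=
  ⟨continuousOn_const, coeFn_zero_X2 j⟩

theorem IsWeakDeriv.add {f f' g g' : N.X2} (hf : IsWeakDeriv f f') (hg : IsWeakDeriv g g') :
    IsWeakDeriv (f + g) (f' + g') := fun j =>
  ((hf j).add (hg j) (integrableOn_X2 f j) (integrableOn_X2 f' j) (integrableOn_X2 g j)
    (integrableOn_X2 g' j)).congr (coeFn_add_X2 f g j).symm (coeFn_add_X2 f' g' j).symm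

theorem IsWeakDeriv.smul {f f' : N.X2} (a : ℂ) (hf : IsWeakDeriv f f') :
    IsWeakDeriv (a • f) (a • f') := fun j =>
  ((hf j).const_mul a).congr (coeFn_smul_X2 a f j).symm (coeFn_smul_X2 a f' j).symm

theorem isWeakDeriv_zero : IsWeakDeriv (0 : N.X2) 0 := fun j =>
  hasWeakDeriv_zero.congr (coeFn_zero_X2 j).symm (coeFn_zero_X2 j).symm

theorem IsWeakDeriv.unique {f f' g' : N.X2} (h : IsWeakDeriv f f') (h' : IsWeakDeriv f g') :
    f' = g' := by
  ext j : 1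
  apply Lp.ext
  exact (Measure.ae_ennreal_smul_measure_iff (N.ofReal_μ_ne_zero j)).2 <| (h j).unique (h' j) (integrableOn_X2 f' j) (integrableOn_X2 g' j)

theorem IsVertexContinuous.add {f g : N.X2} (hf : IsVertexContinuous f)
    (hg : IsVertexContinuous g) : IsVertexContinuous (f + g) := by
  obtain ⟨F, hF, d, h0, h1⟩ := hf
  obtain ⟨G, hG, e, k0, k1⟩ := hg
  refine ⟨fun j x => F j x + G j x, fun j => IsContRep_add (hF j) (hG j), d + e, ?_, ?_⟩
  · rw [Matrix.mulVec_add, h0, k0]; rfl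
  · rw [Matrix.mulVec_add, h1, k1]; rfl

theorem IsVertexContinuous.smul {f : N.X2} (a : ℂ) (hf : IsVertexContinuous f) :
    IsVertexContinuous (a • f) := by
  obtain ⟨F, hF, d, h0, h1⟩ := hf
  refine ⟨fun j x => a * F j x, fun j => IsContRep_smul a (hF j), a • d, ?_, ?_⟩
  · rw [Matrix.mulVec_smul, h0]; rfl
  · rw [Matrix.mulVec_smul, h1]; rfl

theorem isVertexContinuous_zero : IsVertexContinuous (0 : N.X2) :=
  ⟨fun _ _ => 0, fun _ => IsContRep_zero, 0, by rw [Matrix.mulVec_zero]; rfl,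
    by rw [Matrix.mulVec_zero]; rfl⟩

theorem IsKirchhoff.add {f g : N.X2} (hf : IsKirchhoff f) (hg : IsKirchhoff g) :
    IsKirchhoff (f + g) := by
  obtain ⟨F, hF, h⟩ := hf
  obtain ⟨G, hG, k⟩ := hg
  refine ⟨fun j x => F j x + G j x, fun j => IsContRep_add (hF j) (hG j), ?_⟩
  have := congrArg₂ (· + ·) h k
  simp only [← Matrix.mulVec_add] at this
  exact this

theorem IsKirchhoff.smul {f : N.X2} (a : ℂ) (hf : IsKirchhoff f) : IsKirchhoff (a • f) := by
  obtain ⟨F, hF, h⟩ := hf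
  refine ⟨fun j x => a * F j x, fun j => IsContRep_smul a (hF j), ?_⟩
  have := congrArg (a • ·) h
  simp only [← Matrix.mulVec_smul] at this
  exact this

theorem isKirchhoff_zero : IsKirchhoff (0 : N.X2) :=
  ⟨fun _ _ => 0, fun _ => IsContRep_zero, rfl |>.trans (by
    change N.wincPlus *ᵥ (0 : Fin m → ℂ) = N.wincMinus *ᵥ (0 : Fin m → ℂ)
    rw [Matrix.mulVec_zero, Matrix.mulVec_zero])⟩

variable (N)

/-! ### The form `𝔞` and its domain `V` -/

/-- The form domain `V ⊆ (H¹(0,1))^m`. A function `f ∈ (H¹(0,1))^m` is represented by the pair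
`(f, f')`, where `f'` is determined by `f`; the inner product that `V` inherits from `X₂ × X₂` is
therefore `(f, g)_V = ∑_j ∫ (f_j' \bar g_j' + f_j \bar g_j) μ_j dx`. -/
def V : Submodule ℂ (WithLp 2 (N.X2 × N.X2)) where
  carrier := {u | IsWeakDeriv u.fst u.snd ∧ IsVertexContinuous u.fst}
  add_mem' := fun hu hv => ⟨hu.1.add hv.1, hu.2.add hv.2⟩
  zero_mem' := ⟨isWeakDeriv_zero, isVertexContinuous_zero⟩
  smul_mem' := fun a _ hu => ⟨hu.1.smul a, hu.2.smul a⟩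

/-- The inclusion of `V` into `X₂`. -/
def incl : N.V →L[ℂ] N.X2 := (WithLp.fstL 2 ℂ N.X2 N.X2).comp N.V.subtypeL

/-- The derivative `V → X₂`. -/
def derivV : N.V →L[ℂ] N.X2 := (WithLp.sndL 2 ℂ N.X2 N.X2).comp N.V.subtypeL

/-- The form `𝔞(f, g) = ∑_j ∫ μ_j c_j f_j' \bar g_j' dx` on `V`. -/
def form (u v : N.V) : ℂ :=
  ∑ j, ∫ x in Ioo (0 : ℝ) 1, (N.μ j * N.c j x : ℂ) * N.derivV u j x * conj (N.derivV v j x)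

/-! ### The operator `A` -/

/-- The domain `D(A)`: all `f ∈ (H²(0,1))^m` that are continuous at the vertices and satisfy
the Kirchhoff law. -/
def domA : Submodule ℂ N.X2 where
  carrier := {f | ∃ f' f'' : N.X2, IsWeakDeriv f f' ∧ IsWeakDeriv f' f'' ∧
    IsKirchhoff f' ∧ IsVertexContinuous f}
  add_mem' := by
    rintro f g ⟨f', f'', h1, h2, h3, h4⟩ ⟨g', g'', k1, k2, k3, k4⟩
    exact ⟨f' + g', f'' + g'', h1.add k1, h2.add k2, h3.add k3, h4.add k4⟩
  zero_mem' := ⟨0, 0, isWeakDeriv_zero, isWeakDeriv_zero, isKirchhoff_zero,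
    isVertexContinuous_zero⟩
  smul_mem' := by
    rintro a f ⟨f', f'', h1, h2, h3, h4⟩
    exact ⟨a • f', a • f'', h1.smul a, h2.smul a, h3.smul a, h4.smul a⟩

/-- `h_j = (c_j f_j')'` for all `j`, in the sense of weak derivatives. -/
def IsDivForm (f h : N.X2) : Prop :=
  ∃ f' : N.X2, IsWeakDeriv f f' ∧ ∀ j, HasWeakDeriv (fun x => (N.c j x : ℂ) * f' j x) (h j)

variable {N}

theorem memLp_c_mul (f : N.X2) (j : Fin m) :
    MemLp (fun x => (N.c j x : ℂ) * f j x) 2 (volume.restrict (Ioo (0 : ℝ) 1)) := by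
  obtain ⟨K, hK⟩ := isCompact_Icc.exists_bound_of_continuousOn (N.c_continuousOn j)
  refine (memLp_X2 f j).of_le_mul (c := K) ?_ ?_
  · refine AEStronglyMeasurable.mul ?_ (memLp_X2 f j).1
    exact (Complex.continuous_ofReal.comp_continuousOn
      ((N.c_continuousOn j).mono Ioo_subset_Icc_self)).aestronglyMeasurable measurableSet_Ioo
  · filter_upwards [ae_restrict_mem measurableSet_Ioo] with x hx
    rw [norm_mul, Complex.norm_real]
    exact mul_le_mul_of_nonneg_right (hK x (Ioo_subset_Icc_self hx)) (norm_nonneg _)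

theorem integrableOn_c (j : Fin m) : IntegrableOn (N.c j) (Ioo (0 : ℝ) 1) :=
  (N.c_continuousOn j).integrableOn_Icc.mono_set Ioo_subset_Icc_self

theorem exists_isDivForm {f : N.X2} (hf : f ∈ N.domA) : ∃ h, N.IsDivForm f h := by
  obtain ⟨f', f'', h1, h2, -, -⟩ := hf
  have key : ∀ j, ∃ hj : Lp ℂ 2 (N.edgeMeasure j),
      HasWeakDeriv (fun x => (N.c j x : ℂ) * f' j x) hj := by
    intro j
    obtain ⟨c', hc', hcw⟩ := N.c_memH1 j
    obtain ⟨F, hF, hFe⟩ := (h2 j).exists_isContRep (integrableOn_X2 f' j) (integrableOn_X2 f'' j)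
    obtain ⟨K, hK⟩ := isCompact_Icc.exists_bound_of_continuousOn hF
    have hp1 : MemLp (fun x => (c' x : ℂ) * f' j x) 2 (volume.restrict (Ioo (0 : ℝ) 1)) := by
      refine hc'.of_le_mul (c := K) ?_ ?_
      · exact (Complex.continuous_ofReal.comp_aestronglyMeasurable hc'.1).mul (memLp_X2 f' j).1
      · filter_upwards [hFe, ae_restrict_mem measurableSet_Ioo] with x hx hx2
        rw [norm_mul, Complex.norm_real, hx, mul_comm]
        exact mul_le_mul_of_nonneg_right (hK x (Ioo_subset_Icc_self hx2)) (norm_nonneg _)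
    have hp := hp1.add (memLp_c_mul f'' j)
    have hw := hcw.ofReal_mul (h2 j) (integrableOn_c j) (hc'.integrable (by norm_num))
      (integrableOn_X2 f' j) (integrableOn_X2 f'' j)
      ((memLp_c_mul f' j).integrable (by norm_num)) (hp.integrable (by norm_num))
    have hp2 := N.memLp_edge_iff (j := j).2 hp
    exact ⟨hp2.toLp _, hw.congr (ae_of_all _ fun _ => rfl) (N.ae_edge hp2.coeFn_toLp.symm)⟩
  choose h hh using key
  exact ⟨WithLp.toLp 2 h, f', h1, hh⟩

theorem IsDivForm.unique {f h k : N.X2} (hh : N.IsDivForm f h) (hk : N.IsDivForm f k) :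
    h = k := by
  obtain ⟨f', h1, h2⟩ := hh
  obtain ⟨g', k1, k2⟩ := hk
  obtain rfl := h1.unique k1
  ext j : 1
  apply Lp.ext
  exact (Measure.ae_ennreal_smul_measure_iff (N.ofReal_μ_ne_zero j)).2 <| (h2 j).unique (k2 j) (integrableOn_X2 h j) (integrableOn_X2 k j)

theorem IsDivForm.add {f g h k : N.X2} (hh : N.IsDivForm f h) (hk : N.IsDivForm g k) :
    N.IsDivForm (f + g) (h + k) := by
  obtain ⟨f', h1, h2⟩ := hh
  obtain ⟨g', k1, k2⟩ := hk
  refine ⟨f' + g', h1.add k1, fun j => ?_⟩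
  refine ((h2 j).add (k2 j) ((memLp_c_mul f' j).integrable (by norm_num)) (integrableOn_X2 h j)
    ((memLp_c_mul g' j).integrable (by norm_num)) (integrableOn_X2 k j)).congr ?_
    (coeFn_add_X2 h k j).symm
  filter_upwards [coeFn_add_X2 f' g' j] with x hx
  rw [hx, mul_add]

theorem IsDivForm.smul {f h : N.X2} (a : ℂ) (hh : N.IsDivForm f h) :
    N.IsDivForm (a • f) (a • h) := by
  obtain ⟨f', h1, h2⟩ := hh
  refine ⟨a • f', h1.smul a, fun j => ?_⟩
  refine ((h2 j).const_mul a).congr ?_ (coeFn_smul_X2 a h j).symm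
  filter_upwards [coeFn_smul_X2 a f' j] with x hx
  rw [hx, mul_left_comm]

variable (N)

/-- The operator `A f = ((c_j f_j')')_j` in `X₂`, with domain `D(A)`. -/
def A : N.X2 →ₗ.[ℂ] N.X2 where
  domain := N.domA
  toFun :=
    { toFun := fun f => (exists_isDivForm f.2).choose
      map_add' := fun f g => (exists_isDivForm (f + g).2).choose_spec.unique
        ((exists_isDivForm f.2).choose_spec.add (exists_isDivForm g.2).choose_spec)
      map_smul' := fun a f => (exists_isDivForm (a • f).2).choose_spec.unique
        ((exists_isDivForm f.2).choose_spec.smul a) }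

theorem A_graph_iff (f h : N.X2) : (f, h) ∈ N.A.graph ↔ f ∈ N.domA ∧ N.IsDivForm f h := by
  rw [LinearPMap.mem_graph_iff]
  constructor
  · rintro ⟨y, rfl, rfl⟩
    exact ⟨y.2, (exists_isDivForm y.2).choose_spec⟩
  · rintro ⟨hf, hh⟩
    exact ⟨⟨f, hf⟩, rfl, (exists_isDivForm hf).choose_spec.unique hh⟩

end Network

/-! ### Forms, associated operators, cosine functions and phase spaces -/

section Abstract

variable {H W : Type*} [NormedAddCommGroup H] [InnerProductSpace ℂ H]
  [NormedAddCommGroup W] [NormedSpace ℂ W]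

/-- The form norm `√(𝔞(f, f) + ‖f‖²)`; `ι` is the inclusion of the form domain into `H`. -/
def formNorm (ι : W →L[ℂ] H) (a : W → W → ℂ) (u : W) : ℝ :=
  Real.sqrt ((a u u).re + ‖ι u‖ ^ 2)

/-- `a` is a densely defined, symmetric, positive, closed and continuous sesquilinear form on the
Hilbert space `H`, with domain `W` included in `H` by `ι`. -/
structure IsClosedSymmetricForm (ι : W →L[ℂ] H) (a : W → W → ℂ) : Prop where
  injective : Function.Injective ι
  dense : DenseRange ι
  add_left : ∀ u v w, a (u + v) w = a u w + a v w
  smul_left : ∀ (z : ℂ) u v, a (z • u) v = z * a u v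
  symm : ∀ u v, a u v = conj (a v u)
  nonneg : ∀ u, 0 ≤ (a u u).re
  closed : ∀ u : ℕ → W,
    (∀ ε > 0, ∃ k, ∀ p ≥ k, ∀ q ≥ k, formNorm ι a (u p - u q) < ε) →
    ∃ v, Tendsto (fun p => formNorm ι a (u p - v)) atTop (𝓝 0)
  continuous : ∃ M > 0, ∀ u v, ‖a u v‖ ≤ M * formNorm ι a u * formNorm ι a v

/-- `B` is the operator associated with the form `a`: `f ∈ D(B)` and `B f = -g` if and only if
`f` belongs to the form domain and `a(f, h) = (g, h)_H` for all `h` in the form domain. The inner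
product `inner ℂ` is conjugate-linear in its first argument, so `(g, h)_H = inner ℂ h g`. -/
def IsAssociatedOperator (ι : W →L[ℂ] H) (a : W → W → ℂ) (B : H →ₗ.[ℂ] H) : Prop :=
  ∀ f g : H, (f, -g) ∈ B.graph ↔ ∃ u : W, ι u = f ∧ ∀ h : W, a u h = inner ℂ (ι h) g

/-- Dissipativity in a Hilbert space. -/
def IsDissipative (B : H →ₗ.[ℂ] H) : Prop :=
  ∀ f : B.domain, (inner ℂ (B f) (f : H) : ℂ).re ≤ 0

/-- Cosine operator functions: strongly continuous families of bounded operators satisfying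
d'Alembert's functional equation. -/
structure IsCosineFunction (C : ℝ → H →L[ℂ] H) : Prop where
  zero : C 0 = ContinuousLinearMap.id ℂ H
  dalembert : ∀ t s f, C (t + s) f + C (t - s) f = (2 : ℂ) • C t (C s f)
  continuous : ∀ f, Continuous fun t => C t f

/-- `B` is the generator of the cosine function `C`, its second derivative at `0`:
`f ∈ D(B)` and `B f = g` if and only if `2 (C(t) f - f) / t² → g` as `t → 0`. -/
def IsCosineGenerator (B : H →ₗ.[ℂ] H) (C : ℝ → H →L[ℂ] H) : Prop :=
  ∀ f g : H, (f, g) ∈ B.graph ↔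
    Tendsto (fun t : ℝ => ((2 / t ^ 2 : ℝ) : ℂ) • (C t f - f)) (𝓝[≠] 0) (𝓝 g)

/-- Strongly continuous one-parameter groups of bounded operators. -/
structure IsC0Group (T : ℝ → W →L[ℂ] W) : Prop where
  zero : T 0 = ContinuousLinearMap.id ℂ W
  add : ∀ t s u, T (t + s) u = T t (T s u)
  continuous : ∀ u, Continuous fun t => T t u

/-- The relation `G` is the graph of the generator of `T`, its derivative at `0`. -/
def IsGroupGenerator (G : W → W → Prop) (T : ℝ → W →L[ℂ] W) : Prop :=
  ∀ u v : W, G u v ↔ Tendsto (fun t : ℝ => ((t⁻¹ : ℝ) : ℂ) • (T t u - u)) (𝓝[≠] 0) (𝓝 v)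

/-- The graph of the reduction matrix `(0 I; B 0)` on `W × H` with domain `D(B) × W`:
`(u, x) ↦ (x, B u)`. -/
def reductionMatrix (ι : W →L[ℂ] H) (B : H →ₗ.[ℂ] H) (p q : W × H) : Prop :=
  (ι p.1, q.2) ∈ B.graph ∧ ι q.1 = p.2

/-- `W × H` is the phase space associated with `B`: `W` is a Banach space with continuous
inclusions `D(B) ↪ W ↪ H`, where `D(B)` carries the graph norm, and the reduction matrix
`(0 I; B 0)` with domain `D(B) × W` generates a strongly continuous group on `W × H`. -/
structure IsPhaseSpace (ι : W →L[ℂ] H) (B : H →ₗ.[ℂ] H) : Prop where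
  complete : CompleteSpace W
  injective : Function.Injective ι
  domain_le : ∀ f ∈ B.domain, ∃ u, ι u = f
  graph_bound : ∃ K : ℝ, ∀ u g, (ι u, g) ∈ B.graph → ‖u‖ ≤ K * (‖ι u‖ + ‖g‖)
  generates : ∃ T : ℝ → (W × H) →L[ℂ] (W × H),
    IsC0Group T ∧ IsGroupGenerator (reductionMatrix ι B) T

end Abstract

end KirchhoffNetwork

end

/-!
The theorem is a case of a statement about forms, `IsAssociatedOperator.generation`: whenever a
symmetric positive form `a` on a Hilbert space `H` has a complete domain `W`, the operator `A`
associated with it is self-adjoint and dissipative and generates a cosine function with phase space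
`W × H`.

*Abstract part.* The variational problem `a(u, v) + (u, v) = (g, v)` for all `v` has a unique
solution `u = J g`, by the Lax-Milgram theorem (`IsClosedSymmetricForm.exists_solution`). Let `ι`
be the inclusion of `W` in `H`. Then `R = ι J` is the resolvent `(1 - A)⁻¹`; it satisfies
`0 ≤ R ≤ 1` and has dense range, and `(f, g)` is in the graph of `A` if and only if `f = R (f - g)`.
Everything is expressed in terms of `R`, so no unbounded functional calculus is needed.
A function `σ` that is bounded and continuous on `(0, 1]` is applied to `R` by extending
`R x ↦ (r σ(r))(R) x` from the range of `R`, where `r σ(r)` is continuous on `[0, 1]` and the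
continuous functional calculus applies (`symbolCalc`). A point `r` in the spectrum of `R`
corresponds to the frequency `ω = √((1 - r) / r)` of `√(-A)`, so the cosine function is `cos(t ω)`
applied to `R`. Strong convergence follows from uniform convergence of `r σ(r)`, because the range
of `R` is dense (`IsDensePosContraction.tendsto_symbolCalc`).
The square root of `R` yields an isomorphism `U : H ≃ W` with `ι U = √R`
(`exists_equiv_formDomain`), which transports the group generated by the reduction matrix to a
group on `H × H` whose entries are bounded functions of `R` (`waveBlock`).

*Networks.* The form norm is equivalent to the norm of `V` because every `c_j` lies between positive
constants, and `V` is complete because boundary values depend continuously on the function, by the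
trace formulas `F(0) = ∫ (f - (1 - x) f')` and `F(1) = ∫ (f + x f')`. That the form determines `A`
(`Network.isAssociatedOperator`) is integration by parts: for `f ∈ D(A)` and `h ∈ V` the boundary
terms add up to the Kirchhoff sums, weighted with the vertex values of `h`, and vanish. Conversely,
test functions in the interior of the edges show that `c_j f_j'` has a weak derivative in `L²`, and
functions that are affine on every edge, with arbitrary vertex values, give the Kirchhoff law.
-/

noncomputable section

namespace KirchhoffNetwork

/-! ### Functional calculus for a positive contraction with dense range -/

section Calculus

/-- Bounded operators that agree on a dense range are equal. -/
theorem clm_ext_of_denseRange {E F G : Type*} [NormedAddCommGroup E] [NormedSpace ℂ E]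
    [NormedAddCommGroup F] [NormedSpace ℂ F] [NormedAddCommGroup G] [NormedSpace ℂ G]
    {D : E →L[ℂ] F} (hD : DenseRange D) {L L' : F →L[ℂ] G}
    (h : ∀ x, L (D x) = L' (D x)) : L = L' :=
  ContinuousLinearMap.coeFn_injective (hD.equalizer L.continuous L'.continuous (funext h))

variable {H : Type*} [NormedAddCommGroup H] [InnerProductSpace ℂ H] [CompleteSpace H]

/-- A positive contraction with dense range; the example of interest is `(1 - A)⁻¹` for a
self-adjoint operator `A ≤ 0`. -/
structure IsDensePosContraction (R : H →L[ℂ] H) : Prop where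
  nonneg : 0 ≤ R
  le_one : R ≤ 1
  dense : DenseRange R

/-- Real functions that are bounded and continuous on `(0,1]`. -/
structure IsSymbol (f : ℝ → ℝ) : Prop where
  continuousOn : ContinuousOn f (Ioc 0 1)
  bdd : ∃ M, ∀ r ∈ Ioc (0 : ℝ) 1, |f r| ≤ M

/-- The operator `f(R)` for a function `f` that is bounded and continuous on `(0,1]`, where `R` is
a positive contraction with dense range: the continuous extension of `R x ↦ (r f(r))(R) x`. -/
def symbolCalc (R : H →L[ℂ] H) (f : ℝ → ℝ) : H →L[ℂ] H :=
  LinearMap.extendOfNorm (cfc (fun r => r * f r) R : H →L[ℂ] H).toLinearMap (R : H →ₗ[ℂ] H)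

namespace IsDensePosContraction

variable {R : H →L[ℂ] H} (hR : IsDensePosContraction R)
include hR

theorem isSelfAdjoint : IsSelfAdjoint R := IsSelfAdjoint.of_nonneg hR.nonneg

theorem spectrum_subset : spectrum ℝ R ⊆ Icc 0 1 := by
  intro r hr
  refine ⟨spectrum_nonneg_of_nonneg hR.nonneg hr, ?_⟩
  have h := (le_algebraMap_iff_spectrum_le (r := (1 : ℝ)) (a := R) hR.isSelfAdjoint).1
    (by simpa using hR.le_one)
  exact h r hr

/-- The inequality `‖g(R) x‖² ≤ ‖h(R) x‖²` says that `(h² - g²)(R)` is positive. -/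
theorem norm_cfc_apply_le {g h : ℝ → ℝ} (hg : ContinuousOn g (Icc 0 1))
    (hh : ContinuousOn h (Icc 0 1)) (hgh : ∀ r ∈ Icc (0 : ℝ) 1, |g r| ≤ |h r|) (x : H) :
    ‖cfc g R x‖ ≤ ‖cfc h R x‖ := by
  have hg' := hg.mono hR.spectrum_subset
  have hh' := hh.mono hR.spectrum_subset
  have sa : ∀ g : ℝ → ℝ, IsSelfAdjoint (cfc g R) := fun g => cfc_predicate g R
  have key : 0 ≤ cfc h R * cfc h R - cfc g R * cfc g R := by
    rw [← cfc_mul h h R hh' hh', ← cfc_mul g g R hg' hg',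
      ← cfc_sub (fun x => h x * h x) (fun x => g x * g x) R (hh'.mul hh') (hg'.mul hg')]
    refine cfc_nonneg fun r hr => ?_
    exact sub_nonneg.2 (abs_le_iff_mul_self_le.1 (hgh r (hR.spectrum_subset hr)))
  have h1 := ((ContinuousLinearMap.nonneg_iff_isPositive _).1 key).re_inner_nonneg_left x
  have e : ∀ g : ℝ → ℝ, (inner ℂ ((cfc g R * cfc g R) x) x : ℂ) = (‖cfc g R x‖ : ℂ) ^ 2 := by
    intro g
    rw [mul_apply_eq_comp, ← ContinuousLinearMap.adjoint_inner_right,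
      ← ContinuousLinearMap.star_eq_adjoint, (sa g).star_eq, inner_self_eq_norm_sq_to_K]
    rfl
  rw [sub_apply, inner_sub_left, e, e, map_sub, sub_nonneg] at h1
  norm_cast at h1
  exact le_of_sq_le_sq h1 (norm_nonneg _)

theorem cfc_apply_cfc {g h : ℝ → ℝ} (hg : ContinuousOn g (Icc 0 1))
    (hh : ContinuousOn h (Icc 0 1)) (x : H) :
    cfc g R (cfc h R x) = cfc (fun r => g r * h r) R x := by
  rw [cfc_mul g h R (hg.mono hR.spectrum_subset) (hh.mono hR.spectrum_subset), mul_apply_eq_comp]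

theorem cfc_id_apply (x : H) : cfc (fun r : ℝ => r) R x = R x := by
  rw [cfc_id' ℝ R hR.isSelfAdjoint]

theorem cfc_congr_apply {g h : ℝ → ℝ} (e : EqOn g h (Icc 0 1)) (x : H) :
    cfc g R x = cfc h R x := by
  rw [cfc_congr (e.mono hR.spectrum_subset)]

end IsDensePosContraction

/-- Multiplication by the variable makes a symbol continuous up to `0`. -/
theorem IsSymbol.continuousOn_mul {f : ℝ → ℝ} (hf : IsSymbol f) :
    ContinuousOn (fun r => r * f r) (Icc 0 1) := by
  obtain ⟨M, hM⟩ := hf.bdd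
  intro r hr
  rcases eq_or_lt_of_le hr.1 with rfl | h0
  · rw [ContinuousWithinAt, zero_mul]
    refine squeeze_zero_norm' (a := fun r => |r| * M) ?_ ?_
    · filter_upwards [self_mem_nhdsWithin] with s hs
      rcases eq_or_lt_of_le hs.1 with rfl | h
      · simp
      · rw [norm_mul]
        exact mul_le_mul_of_nonneg_left (hM s ⟨h, hs.2⟩) (norm_nonneg _)
    · have : Tendsto (fun r : ℝ => |r| * M) (𝓝 0) (𝓝 (|(0 : ℝ)| * M)) :=
        (continuous_abs.mul continuous_const).tendsto 0
      rw [abs_zero, zero_mul] at this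
      exact this.mono_left nhdsWithin_le_nhds
  · refine (continuousWithinAt_id.mul (hf.continuousOn r ⟨h0, hr.2⟩)).mono_of_mem_nhdsWithin ?_
    rw [mem_nhdsWithin]
    exact ⟨Ioi 0, isOpen_Ioi, h0, fun s hs => ⟨hs.1, hs.2.2⟩⟩

theorem IsSymbol.of_continuousOn {f : ℝ → ℝ} (hf : ContinuousOn f (Icc 0 1)) : IsSymbol f where
  continuousOn := hf.mono Ioc_subset_Icc_self
  bdd := by
    obtain ⟨K, hK⟩ := isCompact_Icc.exists_bound_of_continuousOn hf
    exact ⟨K, fun r hr => hK r (Ioc_subset_Icc_self hr)⟩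

theorem IsSymbol.mul {f g : ℝ → ℝ} (hf : IsSymbol f) (hg : IsSymbol g) :
    IsSymbol fun r => f r * g r where
  continuousOn := hf.continuousOn.mul hg.continuousOn
  bdd := by
    obtain ⟨M, hM⟩ := hf.bdd
    obtain ⟨K, hK⟩ := hg.bdd
    exact ⟨M * K, fun r hr => by
      rw [abs_mul]
      exact mul_le_mul (hM r hr) (hK r hr) (abs_nonneg _) ((abs_nonneg _).trans (hM r hr))⟩

theorem IsSymbol.add {f g : ℝ → ℝ} (hf : IsSymbol f) (hg : IsSymbol g) :
    IsSymbol fun r => f r + g r where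
  continuousOn := hf.continuousOn.add hg.continuousOn
  bdd := by
    obtain ⟨M, hM⟩ := hf.bdd
    obtain ⟨K, hK⟩ := hg.bdd
    exact ⟨M + K, fun r hr => (abs_add_le _ _).trans (add_le_add (hM r hr) (hK r hr))⟩

theorem isSymbol_const (a : ℝ) : IsSymbol fun _ => a := .of_continuousOn continuousOn_const

theorem IsSymbol.sub {f g : ℝ → ℝ} (hf : IsSymbol f) (hg : IsSymbol g) :
    IsSymbol fun r => f r - g r := by
  simpa [sub_eq_add_neg] using hf.add ((isSymbol_const (-1)).mul hg)

namespace IsDensePosContraction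

variable {R : H →L[ℂ] H} (hR : IsDensePosContraction R)
include hR

/-- The bound that allows `R x ↦ (r f(r))(R) x` to be extended continuously. -/
theorem norm_cfc_mul_apply_le {f : ℝ → ℝ} (hf : IsSymbol f) {M : ℝ}
    (hM : ∀ r ∈ Ioc (0 : ℝ) 1, |f r| ≤ M) (x : H) :
    ‖cfc (fun r => r * f r) R x‖ ≤ M * ‖R x‖ := by
  have hM0 : 0 ≤ M := (abs_nonneg _).trans (hM 1 (by simp))
  have h := hR.norm_cfc_apply_le (h := fun r => M * r) hf.continuousOn_mul
    (continuousOn_const.mul (continuousOn_id' _)) (fun r hr => by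
      rcases eq_or_lt_of_le hr.1 with rfl | h0
      · simp
      · rw [abs_mul, abs_mul, abs_of_nonneg hM0, mul_comm]
        exact mul_le_mul_of_nonneg_right (hM r ⟨h0, hr.2⟩) (abs_nonneg _)) x
  have e : cfc (fun r : ℝ => M * r) R = M • R := by
    rw [cfc_const_mul_id M R hR.isSelfAdjoint]
  rwa [e, smul_apply, norm_smul, Real.norm_of_nonneg hM0] at h

theorem symbolCalc_apply {f : ℝ → ℝ} (hf : IsSymbol f) (x : H) :
    symbolCalc R f (R x) = cfc (fun r => r * f r) R x := by
  obtain ⟨M, hM⟩ := hf.bdd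
  exact LinearMap.extendOfNorm_eq (e := (R : H →ₗ[ℂ] H)) hR.dense
    ⟨M, fun x => hR.norm_cfc_mul_apply_le hf hM x⟩ x

theorem norm_symbolCalc_le {f : ℝ → ℝ} (hf : IsSymbol f) {M : ℝ}
    (hM : ∀ r ∈ Ioc (0 : ℝ) 1, |f r| ≤ M) (x : H) : ‖symbolCalc R f x‖ ≤ M * ‖x‖ :=
  LinearMap.norm_extendOfNorm_apply_le (e := (R : H →ₗ[ℂ] H)) hR.dense M
    (fun x => hR.norm_cfc_mul_apply_le hf hM x) x

theorem symbolCalc_congr {f g : ℝ → ℝ} (hf : IsSymbol f) (hg : IsSymbol g)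
    (e : EqOn f g (Ioc 0 1)) : symbolCalc R f = symbolCalc R g := by
  refine clm_ext_of_denseRange hR.dense fun x => ?_
  rw [hR.symbolCalc_apply hf, hR.symbolCalc_apply hg]
  refine hR.cfc_congr_apply (fun r hr => ?_) x
  rcases eq_or_lt_of_le hr.1 with rfl | h0
  · simp
  · simp only [e ⟨h0, hr.2⟩]

theorem symbolCalc_eq_cfc {f : ℝ → ℝ} (hf : ContinuousOn f (Icc 0 1)) :
    symbolCalc R f = cfc f R := by
  refine clm_ext_of_denseRange hR.dense fun x => ?_
  rw [hR.symbolCalc_apply (.of_continuousOn hf), ← hR.cfc_id_apply x,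
    hR.cfc_apply_cfc hf (continuousOn_id' _)]
  simp only [mul_comm]

theorem symbolCalc_const (a : ℝ) (x : H) : symbolCalc R (fun _ => a) x = a • x := by
  rw [hR.symbolCalc_eq_cfc continuousOn_const, cfc_const a R hR.isSelfAdjoint,
    Algebra.algebraMap_eq_smul_one]
  rfl

theorem symbolCalc_id (x : H) : symbolCalc R (fun r => r) x = R x := by
  rw [hR.symbolCalc_eq_cfc (continuousOn_id' _), hR.cfc_id_apply]

theorem symbolCalc_mul {f g : ℝ → ℝ} (hf : IsSymbol f) (hg : IsSymbol g) (x : H) :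
    symbolCalc R f (symbolCalc R g x) = symbolCalc R (fun r => f r * g r) x := by
  revert x
  refine fun x => DFunLike.congr_fun (clm_ext_of_denseRange hR.dense
    (L := (symbolCalc R f).comp (symbolCalc R g)) fun x => ?_) x
  rw [ContinuousLinearMap.comp_apply, hR.symbolCalc_apply hg, hR.symbolCalc_apply (hf.mul hg)]
  -- both sides are continuous in `x`, so that `x` may be taken in the range of `R`
  revert x
  refine fun x => DFunLike.congr_fun (clm_ext_of_denseRange hR.dense
    (L := (symbolCalc R f).comp (cfc (fun r => r * g r) R)) fun y => ?_) x
  have c := hg.continuousOn_mul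
  have c' := hf.continuousOn_mul
  rw [ContinuousLinearMap.comp_apply, ← hR.cfc_id_apply y, hR.cfc_apply_cfc c (continuousOn_id' _),
    hR.cfc_apply_cfc (hf.mul hg).continuousOn_mul (continuousOn_id' _)]
  have e : cfc (fun r => r * g r * r) R y = R (cfc (fun r => r * g r) R y) := by
    rw [← hR.cfc_id_apply, hR.cfc_apply_cfc (continuousOn_id' _) c]
    exact hR.cfc_congr_apply (fun r _ => by ring) y
  rw [e, hR.symbolCalc_apply hf, hR.cfc_apply_cfc c' c]
  exact hR.cfc_congr_apply (fun r _ => by ring) y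

theorem symbolCalc_add {f g : ℝ → ℝ} (hf : IsSymbol f) (hg : IsSymbol g) (x : H) :
    symbolCalc R (fun r => f r + g r) x = symbolCalc R f x + symbolCalc R g x := by
  refine DFunLike.congr_fun (clm_ext_of_denseRange hR.dense
    (L' := symbolCalc R f + symbolCalc R g) fun x => ?_) x
  rw [add_apply, hR.symbolCalc_apply hf, hR.symbolCalc_apply hg,
    hR.symbolCalc_apply (hf.add hg), ← add_apply, ← cfc_add (a := R) _ _
      (hf.continuousOn_mul.mono hR.spectrum_subset) (hg.continuousOn_mul.mono hR.spectrum_subset)]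
  exact hR.cfc_congr_apply (fun r _ => by ring) x

theorem symbolCalc_const_mul (a : ℝ) {f : ℝ → ℝ} (hf : IsSymbol f) (x : H) :
    symbolCalc R (fun r => a * f r) x = a • symbolCalc R f x := by
  rw [← hR.symbolCalc_mul (isSymbol_const a) hf, hR.symbolCalc_const]

theorem symbolCalc_sub {f g : ℝ → ℝ} (hf : IsSymbol f) (hg : IsSymbol g) (x : H) :
    symbolCalc R (fun r => f r - g r) x = symbolCalc R f x - symbolCalc R g x := by
  rw [eq_sub_iff_add_eq, ← hR.symbolCalc_add (hf.sub hg) hg]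
  simp

theorem symbolCalc_comm {f g : ℝ → ℝ} (hf : IsSymbol f) (hg : IsSymbol g) (x : H) :
    symbolCalc R f (symbolCalc R g x) = symbolCalc R g (symbolCalc R f x) := by
  rw [hR.symbolCalc_mul hf hg, hR.symbolCalc_mul hg hf]
  simp only [mul_comm]

/-- Strong continuity of the calculus: it suffices that the symbols are uniformly bounded and that
`r * F i r` converges uniformly, because `R` has dense range. -/
theorem tendsto_symbolCalc {ι : Type*} {l : Filter ι} {F : ι → ℝ → ℝ} {f : ℝ → ℝ}
    (hF : ∀ i, IsSymbol (F i)) (hf : IsSymbol f) (M : ℝ)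
    (hM : ∀ᶠ i in l, ∀ r ∈ Ioc (0 : ℝ) 1, |F i r| ≤ M) (e : ι → ℝ) (he : Tendsto e l (𝓝 0))
    (hFe : ∀ᶠ i in l, ∀ r ∈ Ioc (0 : ℝ) 1, |r * (F i r - f r)| ≤ e i) (x : H) :
    Tendsto (fun i => symbolCalc R (F i) x) l (𝓝 (symbolCalc R f x)) := by
  obtain ⟨K, hK⟩ := hf.bdd
  rw [Metric.tendsto_nhds]
  intro ε hε
  have hMK : 0 < |M| + |K| + 1 := by positivity
  obtain ⟨z, ⟨y, rfl⟩, hy⟩ := Metric.mem_closure_iff.1 (hR.dense x) (ε / 2 / (|M| + |K| + 1))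
    (by positivity)
  have h0 : Tendsto (fun i => e i * ‖y‖) l (𝓝 0) := by simpa using he.mul_const ‖y‖
  filter_upwards [hM, hFe, h0.eventually_lt_const (half_pos hε)] with i h1 h2 h3
  have hD := (hF i).sub hf
  rw [dist_eq_norm, ← hR.symbolCalc_sub (hF i) hf]
  have e1 : symbolCalc R (fun r => F i r - f r) x = symbolCalc R (fun r => F i r - f r) (x - R y)
      + symbolCalc R (fun r => F i r - f r) (R y) := by simp
  rw [e1]
  have b1 : ‖symbolCalc R (fun r => F i r - f r) (x - R y)‖ ≤ (|M| + |K| + 1) * ‖x - R y‖ :=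
    hR.norm_symbolCalc_le hD (fun r hr => (abs_sub _ _).trans (by
      have := (h1 r hr).trans (le_abs_self M)
      have := (hK r hr).trans (le_abs_self K)
      linarith)) _
  have b2 : ‖symbolCalc R (fun r => F i r - f r) (R y)‖ ≤ e i * ‖y‖ := by
    rw [hR.symbolCalc_apply hD]
    have he0 : 0 ≤ e i := (abs_nonneg _).trans (h2 1 (by simp))
    have h := hR.norm_cfc_apply_le (h := fun _ => e i) hD.continuousOn_mul continuousOn_const
      (fun r hr => by
        rw [abs_of_nonneg he0]
        rcases eq_or_lt_of_le hr.1 with rfl | h0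
        · simpa using he0
        · exact h2 r ⟨h0, hr.2⟩) y
    rwa [cfc_const _ R hR.isSelfAdjoint, Algebra.algebraMap_eq_smul_one, smul_apply, norm_smul,
      Real.norm_of_nonneg he0] at h
  rw [dist_eq_norm, lt_div_iff₀ hMK] at hy
  calc _ ≤ _ := norm_add_le _ _
    _ < ε := by linarith

end IsDensePosContraction
end Calculus

/-! ### The functions of the frequency that describe the evolution -/

section Trig

/-- The frequency `√((1 - r) / r)` that corresponds to the point `r` of the spectrum of
`R = (1 - A)⁻¹`, so that `√(-A)` is `freq` of `R`. -/
def freq (r : ℝ) : ℝ := √(1 - r) / √r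

theorem freq_mul_sqrt {r : ℝ} (hr : r ∈ Ioc (0 : ℝ) 1) : freq r * √r = √(1 - r) :=
  div_mul_cancel₀ _ (Real.sqrt_pos.2 hr.1).ne'

theorem freq_nonneg (r : ℝ) : 0 ≤ freq r := by unfold freq; positivity

theorem sqrt_le_one_of_mem {r : ℝ} (hr : r ∈ Ioc (0 : ℝ) 1) : √r ≤ 1 := Real.sqrt_le_one.2 hr.2

theorem sqrt_one_sub_le_one {r : ℝ} (hr : r ∈ Ioc (0 : ℝ) 1) : √(1 - r) ≤ 1 :=
  Real.sqrt_le_one.2 (by linarith [hr.1])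

theorem mul_freq_le_one {r : ℝ} (hr : r ∈ Ioc (0 : ℝ) 1) : r * freq r ≤ 1 := by
  have h1 : r * freq r = √r * √(1 - r) := by
    rw [← freq_mul_sqrt hr]
    nth_rw 1 [← Real.mul_self_sqrt hr.1.le]
    ring
  rw [h1]
  exact mul_le_one₀ (sqrt_le_one_of_mem hr) (Real.sqrt_nonneg _) (sqrt_one_sub_le_one hr)

theorem mul_freq_sq {r : ℝ} (hr : r ∈ Ioc (0 : ℝ) 1) : r * freq r ^ 2 = 1 - r := by
  have h1 : r * freq r ^ 2 = (freq r * √r) ^ 2 := by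
    rw [mul_pow, Real.sq_sqrt hr.1.le, mul_comm]
  rw [h1, freq_mul_sqrt hr, Real.sq_sqrt (by linarith [hr.2])]

theorem mul_freq_sq_le_one {r : ℝ} (hr : r ∈ Ioc (0 : ℝ) 1) : r * freq r ^ 2 ≤ 1 := by
  rw [mul_freq_sq hr]; linarith [hr.1]

theorem continuousOn_freq : ContinuousOn freq (Ioc 0 1) :=
  (Real.continuous_sqrt.comp (continuous_const.sub continuous_id)).continuousOn.div
    Real.continuous_sqrt.continuousOn fun _ hr => (Real.sqrt_pos.2 hr.1).ne'

theorem mul_sinc (x : ℝ) : x * Real.sinc x = Real.sin x := by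
  rcases eq_or_ne x 0 with rfl | h
  · simp
  · rw [Real.sinc_of_ne_zero h, mul_div_cancel₀ _ h]

theorem abs_sinc_sub_one_le (x : ℝ) : |Real.sinc x - 1| ≤ x ^ 2 := by
  rcases eq_or_ne x 0 with rfl | h
  · simp
  · have h1 := Real.abs_sub_sin_le x
    have h2 : Real.sinc x - 1 = -((x - Real.sin x) / x) := by
      rw [Real.sinc_of_ne_zero h]; field_simp; ring
    rw [h2, abs_neg, abs_div, div_le_iff₀ (abs_pos.2 h)]
    have h3 : |x| ^ 3 = x ^ 2 * |x| := by rw [← sq_abs]; ring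
    have h4 : 0 ≤ x ^ 2 * |x| := by positivity
    linarith

theorem abs_sinc_sq_sub_one_le (x : ℝ) : |Real.sinc x ^ 2 - 1| ≤ 2 * x ^ 2 := by
  have h : Real.sinc x ^ 2 - 1 = (Real.sinc x + 1) * (Real.sinc x - 1) := by ring
  rw [h, abs_mul]
  refine mul_le_mul ((abs_add_le _ _).trans ?_) (abs_sinc_sub_one_le x) (abs_nonneg _) (by norm_num)
  rw [abs_one]
  linarith [Real.abs_sinc_le_one x]

theorem cos_sub_one_eq (x : ℝ) : Real.cos x - 1 = -(x ^ 2 / 2) * Real.sinc (x / 2) ^ 2 := by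
  have h1 : Real.cos x = 2 * Real.cos (x / 2) ^ 2 - 1 := by
    rw [← Real.cos_two_mul]; ring_nf
  have h2 := mul_sinc (x / 2)
  have h3 := Real.sin_sq_add_cos_sq (x / 2)
  rw [← h2] at h3
  rw [h1]
  linear_combination 2 * h3

theorem abs_mul_sinc_sub_le (w t s : ℝ) :
    |t * Real.sinc (t * w) - s * Real.sinc (s * w)| ≤ |t - s| := by
  rcases eq_or_ne w 0 with rfl | h
  · simp
  · have e : ∀ t, t * Real.sinc (t * w) = Real.sin (t * w) / w := fun t => by
      rw [eq_div_iff h, ← mul_sinc]; ring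
    rw [e, e, ← sub_div, abs_div, div_le_iff₀ (abs_pos.2 h), ← abs_mul, sub_mul]
    exact Real.abs_sin_sub_sin_le _ _

/-- The symbol of `C(t) = cos(t √(-A))`. -/
def cosSymbol (t r : ℝ) : ℝ := Real.cos (t * freq r)

/-- The symbol of `sinc(t √(-A))`. -/
def sincSymbol (t r : ℝ) : ℝ := Real.sinc (t * freq r)

/-- The symbol of `√(1 - A) sin(t √(-A)) / √(-A)`. -/
def upperSymbol (t r : ℝ) : ℝ := t / √r * Real.sinc (t * freq r)

/-- The symbol of `(1 - A)^(-1/2) √(-A) sin(t √(-A))`. -/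
def lowerSymbol (t r : ℝ) : ℝ := √(1 - r) * Real.sin (t * freq r)

theorem isSymbol_cos (t : ℝ) : IsSymbol (cosSymbol t) where
  continuousOn := Real.continuous_cos.comp_continuousOn (continuousOn_const.mul continuousOn_freq)
  bdd := ⟨1, fun _ _ => Real.abs_cos_le_one _⟩

theorem isSymbol_sinc (t : ℝ) : IsSymbol (sincSymbol t) where
  continuousOn := Real.continuous_sinc.comp_continuousOn (continuousOn_const.mul continuousOn_freq)
  bdd := ⟨1, fun _ _ => Real.abs_sinc_le_one _⟩

theorem isSymbol_sqrt : IsSymbol fun r => √r := .of_continuousOn Real.continuous_sqrt.continuousOn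

theorem isSymbol_id : IsSymbol fun r => r := .of_continuousOn continuousOn_id

theorem isSymbol_sqrt_one_sub : IsSymbol fun r => √(1 - r) :=
  .of_continuousOn (Real.continuous_sqrt.comp (continuous_const.sub continuous_id)).continuousOn

theorem abs_lowerSymbol_le (t : ℝ) {r : ℝ} (hr : r ∈ Ioc (0 : ℝ) 1) : |lowerSymbol t r| ≤ 1 := by
  rw [lowerSymbol, abs_mul, abs_of_nonneg (Real.sqrt_nonneg _)]
  exact mul_le_one₀ (sqrt_one_sub_le_one hr) (abs_nonneg _) (Real.abs_sin_le_one _)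

theorem isSymbol_lower (t : ℝ) : IsSymbol (lowerSymbol t) where
  continuousOn := isSymbol_sqrt_one_sub.continuousOn.mul
    (Real.continuous_sin.comp_continuousOn (continuousOn_const.mul continuousOn_freq))
  bdd := ⟨1, fun _ => abs_lowerSymbol_le t⟩

theorem upperSymbol_mul (t r : ℝ) :
    upperSymbol t r * √(1 - r) = Real.sin (t * freq r) := by
  rw [← mul_sinc, upperSymbol, freq]; ring

/-- Near `r = 0` the denominator `√(1 - r)` of `sin(t freq r) / √(1 - r)` is bounded below, near
`r = 1` one uses `|sinc| ≤ 1`. -/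
theorem abs_upperSymbol_le (t r : ℝ) :
    |upperSymbol t r| ≤ 2 * (1 + |t|) := by
  rcases le_total r (1 / 2) with h | h
  · have hk : 1 / 2 ≤ √(1 - r) := Real.le_sqrt_of_sq_le (by linarith)
    have h1 := congrArg abs (upperSymbol_mul t r)
    rw [abs_mul, abs_of_nonneg (Real.sqrt_nonneg _)] at h1
    have h2 := Real.abs_sin_le_one (t * freq r)
    have h3 := mul_le_mul_of_nonneg_left hk (abs_nonneg (upperSymbol t r))
    linarith [abs_nonneg t]
  · have hb : 1 / 2 ≤ √r := Real.le_sqrt_of_sq_le (by linarith)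
    rw [upperSymbol, abs_mul, abs_div, abs_of_nonneg (Real.sqrt_nonneg r)]
    have h1 : |t| / √r ≤ 2 * |t| := by
      rw [div_le_iff₀ (by linarith)]
      nlinarith [abs_nonneg t]
    have h2 := mul_le_mul h1 (Real.abs_sinc_le_one (t * freq r)) (abs_nonneg _) (by positivity)
    linarith

theorem isSymbol_upper (t : ℝ) : IsSymbol (upperSymbol t) where
  continuousOn := (continuousOn_const.div isSymbol_sqrt.continuousOn
    fun _ hr => (Real.sqrt_pos.2 hr.1).ne').mul (isSymbol_sinc t).continuousOn
  bdd := ⟨_, fun r _ => abs_upperSymbol_le t r⟩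

theorem cosSymbol_add (t s r : ℝ) : cosSymbol (t + s) r
    = cosSymbol t r * cosSymbol s r - upperSymbol t r * lowerSymbol s r := by
  rw [lowerSymbol, ← mul_assoc, upperSymbol_mul t r, cosSymbol, add_mul, Real.cos_add]
  rfl

theorem lowerSymbol_add (t s r : ℝ) : lowerSymbol (t + s) r
    = lowerSymbol t r * cosSymbol s r + cosSymbol t r * lowerSymbol s r := by
  simp only [lowerSymbol, cosSymbol]
  rw [add_mul, Real.sin_add]
  ring

theorem upperSymbol_add (t s : ℝ) {r : ℝ} (hr : r ∈ Ioc (0 : ℝ) 1) : upperSymbol (t + s) r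
    = cosSymbol t r * upperSymbol s r + upperSymbol t r * cosSymbol s r := by
  rcases eq_or_lt_of_le hr.2 with rfl | h
  · simp [upperSymbol, cosSymbol, freq]
    ring
  · have hk : √(1 - r) ≠ 0 := (Real.sqrt_pos.2 (by linarith)).ne'
    apply mul_right_cancel₀ hk
    rw [upperSymbol_mul _ r, add_mul, Real.sin_add, ← upperSymbol_mul t r, ← upperSymbol_mul s r,
      cosSymbol, cosSymbol]
    ring

end Trig

/-! ### The cosine function -/

section Evolution

variable {H : Type*} [NormedAddCommGroup H] [InnerProductSpace ℂ H] [CompleteSpace H]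

namespace IsDensePosContraction

variable {R : H →L[ℂ] H} (hR : IsDensePosContraction R)
include hR

theorem tendsto_cos (s : ℝ) (x : H) : Tendsto (fun t => symbolCalc R (cosSymbol t) x) (𝓝 s)
    (𝓝 (symbolCalc R (cosSymbol s) x)) := by
  refine hR.tendsto_symbolCalc isSymbol_cos (isSymbol_cos s) 1
    (Eventually.of_forall fun t r _ => Real.abs_cos_le_one _) (fun t => |t - s|) ?_
    (Eventually.of_forall fun t r hr => ?_) x
  · have : Tendsto (fun t => |t - s|) (𝓝 s) (𝓝 |s - s|) := Continuous.tendsto (by fun_prop) s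
    simpa using this
  · have h := Real.abs_cos_sub_cos_le (t * freq r) (s * freq r)
    rw [← sub_mul, abs_mul, abs_of_nonneg (freq_nonneg r)] at h
    rw [abs_mul, abs_of_pos hr.1]
    calc r * |cosSymbol t r - cosSymbol s r| ≤ r * (|t - s| * freq r) :=
          mul_le_mul_of_nonneg_left h hr.1.le
      _ = |t - s| * (r * freq r) := by ring
      _ ≤ |t - s| := mul_le_of_le_one_right (abs_nonneg _) (mul_freq_le_one hr)

theorem tendsto_lower (s : ℝ) (x : H) : Tendsto (fun t => symbolCalc R (lowerSymbol t) x) (𝓝 s)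
    (𝓝 (symbolCalc R (lowerSymbol s) x)) := by
  refine hR.tendsto_symbolCalc isSymbol_lower (isSymbol_lower s) 1
    (Eventually.of_forall fun t r hr => abs_lowerSymbol_le t hr) (fun t => |t - s|) ?_
    (Eventually.of_forall fun t r hr => ?_) x
  · have : Tendsto (fun t => |t - s|) (𝓝 s) (𝓝 |s - s|) := Continuous.tendsto (by fun_prop) s
    simpa using this
  · have h := Real.abs_sin_sub_sin_le (t * freq r) (s * freq r)
    rw [← sub_mul, abs_mul, abs_of_nonneg (freq_nonneg r)] at h
    rw [lowerSymbol, lowerSymbol, ← mul_sub, abs_mul, abs_of_pos hr.1, abs_mul,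
      abs_of_nonneg (Real.sqrt_nonneg _)]
    calc r * (√(1 - r) * |Real.sin (t * freq r) - Real.sin (s * freq r)|)
        ≤ r * (1 * (|t - s| * freq r)) := by
          gcongr
          · exact hr.1.le
          · exact sqrt_one_sub_le_one hr
      _ = |t - s| * (r * freq r) := by ring
      _ ≤ |t - s| := mul_le_of_le_one_right (abs_nonneg _) (mul_freq_le_one hr)

theorem tendsto_upper (s : ℝ) (x : H) : Tendsto (fun t => symbolCalc R (upperSymbol t) x) (𝓝 s)
    (𝓝 (symbolCalc R (upperSymbol s) x)) := by
  have hc : Tendsto (fun t => |t - s|) (𝓝 s) (𝓝 0) := by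
    have : Tendsto (fun t => |t - s|) (𝓝 s) (𝓝 |s - s|) := Continuous.tendsto (by fun_prop) s
    simpa using this
  refine hR.tendsto_symbolCalc isSymbol_upper (isSymbol_upper s) (2 * (1 + (|s| + 1))) ?_
    (fun t => |t - s|) hc (Eventually.of_forall fun t r hr => ?_) x
  · filter_upwards [hc.eventually_lt_const one_pos] with t ht r _
    refine (abs_upperSymbol_le t r).trans ?_
    have := abs_sub_abs_le_abs_sub t s
    linarith
  · have e : r * (upperSymbol t r - upperSymbol s r)
        = √r * (t * Real.sinc (t * freq r) - s * Real.sinc (s * freq r)) := by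
      have hb := (Real.sqrt_pos.2 hr.1).ne'
      rw [upperSymbol, upperSymbol]
      nth_rw 1 [← Real.mul_self_sqrt hr.1.le]
      field_simp
    rw [e, abs_mul, abs_of_nonneg (Real.sqrt_nonneg _)]
    exact (mul_le_of_le_one_left (abs_nonneg _) (sqrt_le_one_of_mem hr)).trans
      (abs_mul_sinc_sub_le _ _ _)

/-- `sinc(t √(-A)) → 1` strongly as `t → 0`. -/
theorem tendsto_sinc (x : H) :
    Tendsto (fun t => symbolCalc R (sincSymbol t) x) (𝓝 0) (𝓝 x) := by
  have h := hR.tendsto_symbolCalc isSymbol_sinc (isSymbol_const 1) 1 (l := 𝓝 0)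
    (Eventually.of_forall fun t r _ => Real.abs_sinc_le_one _) (fun t => t ^ 2)
    (by simpa using (continuous_pow 2).tendsto (0 : ℝ))
    (Eventually.of_forall fun t r hr => by
      rw [abs_mul, abs_of_pos hr.1]
      calc r * |sincSymbol t r - 1| ≤ r * (t * freq r) ^ 2 :=
            mul_le_mul_of_nonneg_left (abs_sinc_sub_one_le _) hr.1.le
        _ = t ^ 2 * (r * freq r ^ 2) := by ring
        _ ≤ t ^ 2 := mul_le_of_le_one_right (sq_nonneg _) (mul_freq_sq_le_one hr)) x
  rwa [hR.symbolCalc_const, one_smul] at h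

theorem tendsto_sinc_sq (x : H) : Tendsto
    (fun t => symbolCalc R (fun r => sincSymbol (t / 2) r * sincSymbol (t / 2) r) x)
    (𝓝 0) (𝓝 x) := by
  have h := hR.tendsto_symbolCalc
    (F := fun t r => sincSymbol (t / 2) r * sincSymbol (t / 2) r)
    (fun t => (isSymbol_sinc (t / 2)).mul (isSymbol_sinc (t / 2)))
    (isSymbol_const 1) 1 (l := 𝓝 0)
    (Eventually.of_forall fun t r _ => by
      rw [abs_mul]
      exact mul_le_one₀ (Real.abs_sinc_le_one _) (abs_nonneg _) (Real.abs_sinc_le_one _))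
    (fun t => t ^ 2) (by simpa using (continuous_pow 2).tendsto (0 : ℝ))
    (Eventually.of_forall fun t r hr => by
      rw [abs_mul, abs_of_pos hr.1, ← sq]
      calc r * |sincSymbol (t / 2) r ^ 2 - 1| ≤ r * (2 * (t / 2 * freq r) ^ 2) :=
            mul_le_mul_of_nonneg_left (abs_sinc_sq_sub_one_le _) hr.1.le
        _ = t ^ 2 / 2 * (r * freq r ^ 2) := by ring
        _ ≤ t ^ 2 / 2 := mul_le_of_le_one_right (by positivity) (mul_freq_sq_le_one hr)
        _ ≤ t ^ 2 := half_le_self (sq_nonneg t)) x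
  rwa [hR.symbolCalc_const, one_smul] at h

theorem injective : Function.Injective R := by
  rw [injective_iff_map_eq_zero]
  intro x hx
  -- `x` is orthogonal to the range of `R`
  refine hR.dense.eq_zero_of_inner_left ℂ fun y => ?_
  rw [← ContinuousLinearMap.adjoint_inner_left, ← ContinuousLinearMap.star_eq_adjoint,
    hR.isSelfAdjoint.star_eq, hx, inner_zero_left]

theorem sqrt_sqrt (x : H) :
    symbolCalc R (fun r => √r) (symbolCalc R (fun r => √r) x) = R x := by
  rw [hR.symbolCalc_mul isSymbol_sqrt isSymbol_sqrt, ← hR.symbolCalc_id]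
  rw [hR.symbolCalc_congr (isSymbol_sqrt.mul isSymbol_sqrt) isSymbol_id
    fun r hr => Real.mul_self_sqrt hr.1.le]

/-- The square root of `R` is injective because `R` is. -/
theorem sqrt_injective : Function.Injective (symbolCalc R fun r => √r) := fun x y h =>
  hR.injective (by rw [← hR.sqrt_sqrt, h, hR.sqrt_sqrt])

/-- The operators `cos(t √(-A))` form a cosine function. -/
theorem isCosineFunction : IsCosineFunction fun t => symbolCalc R (cosSymbol t) where
  zero := by
    ext x
    have : cosSymbol 0 = fun _ => 1 := by ext r; simp [cosSymbol]
    rw [this, hR.symbolCalc_const, one_smul]; rfl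
  dalembert t s f := by
    rw [hR.symbolCalc_mul (isSymbol_cos t) (isSymbol_cos s),
      ← hR.symbolCalc_add (isSymbol_cos _) (isSymbol_cos _)]
    have h := hR.symbolCalc_const_mul 2 ((isSymbol_cos t).mul (isSymbol_cos s)) f
    rw [← Complex.coe_smul] at h
    rw [← Complex.ofReal_ofNat, ← h]
    congr 2 with r
    simp only [cosSymbol]
    rw [add_mul, sub_mul, Real.cos_add, Real.cos_sub]
    ring
  continuous f := continuous_iff_continuousAt.2 fun s => hR.tendsto_cos s f

/-- On the range of `R`, the second difference quotients of `cos(t √(-A))` at `0` converge to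
`A R = R - 1`. -/
theorem tendsto_cos_second (y : H) : Tendsto
    (fun t : ℝ => ((2 / t ^ 2 : ℝ) : ℂ) • (symbolCalc R (cosSymbol t) (R y) - R y)) (𝓝[≠] 0)
    (𝓝 (R y - y)) := by
  have h := (((symbolCalc R fun r => r - 1).continuous.tendsto y).comp
    (hR.tendsto_sinc_sq y)).mono_left (nhdsWithin_le_nhds (s := {0}ᶜ))
  rw [hR.symbolCalc_sub isSymbol_id (isSymbol_const 1), hR.symbolCalc_id, hR.symbolCalc_const,
    one_smul] at h
  refine h.congr' ?_
  filter_upwards [self_mem_nhdsWithin] with t ht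
  have ht0 : t ≠ 0 := ht
  have hq := (isSymbol_sinc (t / 2)).mul (isSymbol_sinc (t / 2))
  have h1 := isSymbol_id.sub (isSymbol_const 1)
  have h2 := (isSymbol_cos t).mul isSymbol_id
  rw [Function.comp_apply, hR.symbolCalc_mul h1 hq, Complex.coe_smul]
  rw [← hR.symbolCalc_id y]
  rw [hR.symbolCalc_mul (isSymbol_cos t) isSymbol_id, ← hR.symbolCalc_sub h2 isSymbol_id,
    ← hR.symbolCalc_const_mul _ (h2.sub isSymbol_id)]
  rw [hR.symbolCalc_congr (h1.mul hq) ((isSymbol_const _).mul (h2.sub isSymbol_id))]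
  intro r hr
  have e1 := cos_sub_one_eq (t * freq r)
  have e2 := mul_freq_sq hr
  have e3 : t * freq r / 2 = t / 2 * freq r := by ring
  rw [e3] at e1
  simp only [sincSymbol, cosSymbol]
  rw [← sub_one_mul, e1]
  generalize Real.sinc (t / 2 * freq r) = q
  field_simp
  linear_combination (q ^ 2) * e2

/-- If `R = (1 - B)⁻¹`, then `B` generates the cosine function `cos(t √(-B))`. -/
theorem isCosineGenerator {B : H →ₗ.[ℂ] H} (hB : ∀ f g, (f, g) ∈ B.graph ↔ f = R (f - g)) :
    IsCosineGenerator B fun t => symbolCalc R (cosSymbol t) := by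
  intro f g
  rw [hB]
  constructor
  · intro h
    have h1 := hR.tendsto_cos_second (f - g)
    rw [← h, sub_sub_cancel] at h1
    exact h1
  · intro h
    -- `R` commutes with `C t` and regularizes
    have h1 := (R.continuous.tendsto g).comp h
    have h2 := hR.tendsto_cos_second f
    have h3 : R g = R f - f := by
      refine tendsto_nhds_unique (h1.congr fun t => ?_) h2
      simp only [Function.comp_apply]
      rw [map_smul, map_sub, ← hR.symbolCalc_id (symbolCalc R _ f),
        hR.symbolCalc_comm isSymbol_id (isSymbol_cos t), hR.symbolCalc_id]
    rw [map_sub, h3, sub_sub_cancel]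

end IsDensePosContraction

end Evolution

/-! ### The group on the phase space -/

section Groups

variable {H : Type*} [NormedAddCommGroup H] [InnerProductSpace ℂ H] [CompleteSpace H]

/-- The group generated by `(0 I; A 0)`, in the coordinates on `H × H` in which the first
component `u` of the phase space is replaced by `(1 - A)^(1/2) u`. -/
def waveBlock (R : H →L[ℂ] H) (t : ℝ) : (H × H) →L[ℂ] (H × H) :=
  ((symbolCalc R (cosSymbol t)).comp (.fst ℂ H H)
    + (symbolCalc R (upperSymbol t)).comp (.snd ℂ H H)).prod
  ((symbolCalc R (cosSymbol t)).comp (.snd ℂ H H)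
    - (symbolCalc R (lowerSymbol t)).comp (.fst ℂ H H))

theorem waveBlock_apply (R : H →L[ℂ] H) (t : ℝ) (p : H × H) : waveBlock R t p
    = (symbolCalc R (cosSymbol t) p.1 + symbolCalc R (upperSymbol t) p.2,
      symbolCalc R (cosSymbol t) p.2 - symbolCalc R (lowerSymbol t) p.1) := rfl

namespace IsDensePosContraction

variable {R : H →L[ℂ] H} (hR : IsDensePosContraction R)
include hR

theorem isC0Group_waveBlock : IsC0Group (waveBlock R) where
  zero := by
    have h1 : cosSymbol 0 = fun _ => 1 := by ext r; simp [cosSymbol]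
    have h2 : upperSymbol 0 = fun _ => 0 := by ext r; simp [upperSymbol]
    have h3 : lowerSymbol 0 = fun _ => 0 := by ext r; simp [lowerSymbol]
    refine ContinuousLinearMap.ext fun p => ?_
    rw [waveBlock_apply, h1, h2, h3]
    simp only [hR.symbolCalc_const, one_smul, zero_smul, add_zero, sub_zero]
    rfl
  add t s p := by
    have c := fun t => isSymbol_cos t
    have u := fun t => isSymbol_upper t
    have l := fun t => isSymbol_lower t
    have e1 : ∀ x, symbolCalc R (cosSymbol (t + s)) x
        = symbolCalc R (cosSymbol t) (symbolCalc R (cosSymbol s) x)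
          - symbolCalc R (upperSymbol t) (symbolCalc R (lowerSymbol s) x) := fun x => by
      rw [hR.symbolCalc_mul (c t) (c s), hR.symbolCalc_mul (u t) (l s),
        ← hR.symbolCalc_sub ((c t).mul (c s)) ((u t).mul (l s))]
      rw [hR.symbolCalc_congr (c _) (((c t).mul (c s)).sub ((u t).mul (l s)))
        fun r _ => cosSymbol_add t s r]
    have e2 : ∀ x, symbolCalc R (upperSymbol (t + s)) x
        = symbolCalc R (cosSymbol t) (symbolCalc R (upperSymbol s) x)
          + symbolCalc R (upperSymbol t) (symbolCalc R (cosSymbol s) x) := fun x => by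
      rw [hR.symbolCalc_mul (c t) (u s), hR.symbolCalc_mul (u t) (c s),
        ← hR.symbolCalc_add ((c t).mul (u s)) ((u t).mul (c s))]
      rw [hR.symbolCalc_congr (u _) (((c t).mul (u s)).add ((u t).mul (c s)))
        fun r hr => upperSymbol_add t s hr]
    have e3 : ∀ x, symbolCalc R (lowerSymbol (t + s)) x
        = symbolCalc R (lowerSymbol t) (symbolCalc R (cosSymbol s) x)
          + symbolCalc R (cosSymbol t) (symbolCalc R (lowerSymbol s) x) := fun x => by
      rw [hR.symbolCalc_mul (c t) (l s), hR.symbolCalc_mul (l t) (c s),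
        ← hR.symbolCalc_add ((l t).mul (c s)) ((c t).mul (l s))]
      rw [hR.symbolCalc_congr (l _) (((l t).mul (c s)).add ((c t).mul (l s)))
        fun r _ => lowerSymbol_add t s r]
    have e4 : ∀ x, symbolCalc R (cosSymbol (t + s)) x
        = symbolCalc R (cosSymbol t) (symbolCalc R (cosSymbol s) x)
          - symbolCalc R (lowerSymbol t) (symbolCalc R (upperSymbol s) x) := fun x => by
      rw [add_comm t s, hR.symbolCalc_comm (c t) (c s), hR.symbolCalc_comm (l t) (u s)]
      rw [hR.symbolCalc_mul (c s) (c t), hR.symbolCalc_mul (u s) (l t),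
        ← hR.symbolCalc_sub ((c s).mul (c t)) ((u s).mul (l t))]
      rw [hR.symbolCalc_congr (c _) (((c s).mul (c t)).sub ((u s).mul (l t)))
        fun r _ => cosSymbol_add s t r]
    simp only [waveBlock_apply, map_add, map_sub]
    refine Prod.ext ?_ ?_
    · change symbolCalc R (cosSymbol (t + s)) p.1 + symbolCalc R (upperSymbol (t + s)) p.2 = _
      rw [e1, e2]; dsimp only; abel
    · change symbolCalc R (cosSymbol (t + s)) p.2 - symbolCalc R (lowerSymbol (t + s)) p.1 = _
      rw [e4, e3]; dsimp only; abel
  continuous p := continuous_iff_continuousAt.2 fun s =>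
    ((hR.tendsto_cos s p.1).add (hR.tendsto_upper s p.2)).prodMk_nhds
      ((hR.tendsto_cos s p.2).sub (hR.tendsto_lower s p.1))

/-- `t⁻¹ (cos(t √(-A)) - 1) (1 - A)^(-1/2) → 0` strongly as `t → 0`. -/
theorem tendsto_cos_slope (s : H) : Tendsto (fun t : ℝ => t⁻¹ •
    (symbolCalc R (cosSymbol t) (symbolCalc R (fun r => √r) s) - symbolCalc R (fun r => √r) s))
    (𝓝[≠] 0) (𝓝 0) := by
  have h0 : lowerSymbol 0 = fun _ => 0 := by ext r; simp [lowerSymbol]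
  have h1 : Tendsto (fun t : ℝ => t / 2) (𝓝[≠] 0) (𝓝 0) := by
    have : Tendsto (fun t : ℝ => t / 2) (𝓝 0) (𝓝 (0 / 2)) := Continuous.tendsto (by fun_prop) 0
    rw [zero_div] at this
    exact this.mono_left nhdsWithin_le_nhds
  have h2 := ((hR.tendsto_lower 0 s).comp h1).norm
  rw [h0, hR.symbolCalc_const, zero_smul, norm_zero] at h2
  refine squeeze_zero_norm' ?_ h2
  filter_upwards [self_mem_nhdsWithin] with t ht
  have ht0 : t ≠ 0 := ht
  have c := isSymbol_cos t
  have b := isSymbol_sqrt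
  have hs := (isSymbol_const (-1)).mul ((isSymbol_sinc (t / 2)).mul (isSymbol_lower (t / 2)))
  rw [hR.symbolCalc_mul c b, ← hR.symbolCalc_sub (c.mul b) b,
    ← hR.symbolCalc_const_mul _ ((c.mul b).sub b),
    hR.symbolCalc_congr ((isSymbol_const _).mul ((c.mul b).sub b)) hs, hR.symbolCalc_const_mul _
      ((isSymbol_sinc (t / 2)).mul (isSymbol_lower (t / 2))),
    ← hR.symbolCalc_mul (isSymbol_sinc (t / 2)) (isSymbol_lower (t / 2)), neg_one_smul, norm_neg]
  · refine (hR.norm_symbolCalc_le (isSymbol_sinc (t / 2)) (M := 1)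
      (fun r _ => Real.abs_sinc_le_one _) _).trans ?_
    rw [one_mul, Function.comp_apply]
  · intro r hr
    have e1 := cos_sub_one_eq (t * freq r)
    have e2 := mul_sinc (t / 2 * freq r)
    have e3 : t * freq r / 2 = t / 2 * freq r := by ring
    rw [e3] at e1
    simp only [sincSymbol, cosSymbol, lowerSymbol]
    rw [← sub_one_mul, e1, ← e2, ← freq_mul_sqrt hr]
    generalize Real.sinc (t / 2 * freq r) = q
    field_simp

/-- On the range of `R^(1/2)`, the difference quotients of the group converge to the conjugate of
the reduction matrix. -/
theorem tendsto_waveBlock (s q : H) : Tendsto (fun t : ℝ => ((t⁻¹ : ℝ) : ℂ) •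
    (waveBlock R t (symbolCalc R (fun r => √r) s, symbolCalc R (fun r => √r) q)
      - (symbolCalc R (fun r => √r) s, symbolCalc R (fun r => √r) q)))
    (𝓝[≠] 0) (𝓝 (q, R s - s)) := by
  have b := isSymbol_sqrt
  have h1 := isSymbol_id.sub (isSymbol_const 1)
  have hu : Tendsto (fun t : ℝ => t⁻¹ • symbolCalc R (upperSymbol t)
      (symbolCalc R (fun r => √r) q)) (𝓝[≠] 0) (𝓝 q) := by
    refine ((hR.tendsto_sinc q).mono_left nhdsWithin_le_nhds).congr' ?_
    filter_upwards [self_mem_nhdsWithin] with t ht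
    have ht0 : t ≠ 0 := ht
    rw [hR.symbolCalc_mul (isSymbol_upper t) b, ← hR.symbolCalc_const_mul _
      ((isSymbol_upper t).mul b), hR.symbolCalc_congr (isSymbol_sinc t)
      ((isSymbol_const _).mul ((isSymbol_upper t).mul b))]
    intro r hr
    have hb := (Real.sqrt_pos.2 hr.1).ne'
    simp only [sincSymbol, upperSymbol]
    generalize Real.sinc (t * freq r) = q
    field_simp
  have hl : Tendsto (fun t : ℝ => t⁻¹ • -symbolCalc R (lowerSymbol t)
      (symbolCalc R (fun r => √r) s)) (𝓝[≠] 0) (𝓝 (R s - s)) := by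
    have h := (((symbolCalc R fun r => r - 1).continuous.tendsto s).comp
      (hR.tendsto_sinc s)).mono_left (nhdsWithin_le_nhds (s := {0}ᶜ))
    rw [hR.symbolCalc_sub isSymbol_id (isSymbol_const 1), hR.symbolCalc_id, hR.symbolCalc_const,
      one_smul] at h
    refine h.congr' ?_
    filter_upwards [self_mem_nhdsWithin] with t ht
    have ht0 : t ≠ 0 := ht
    rw [Function.comp_apply, hR.symbolCalc_mul h1 (isSymbol_sinc t), smul_neg, ← neg_smul,
      hR.symbolCalc_mul (isSymbol_lower t) b, ← hR.symbolCalc_const_mul _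
      ((isSymbol_lower t).mul b), hR.symbolCalc_congr (h1.mul (isSymbol_sinc t))
      ((isSymbol_const _).mul ((isSymbol_lower t).mul b))]
    intro r hr
    have e1 : √(1 - r) * √(1 - r) = 1 - r := Real.mul_self_sqrt (by linarith [hr.2])
    have e2 := freq_mul_sqrt hr
    simp only [sincSymbol, lowerSymbol]
    rw [← mul_sinc]
    generalize Real.sinc (t * freq r) = q
    field_simp
    linear_combination q * e1 + q * √(1 - r) * e2
  have k1 := (hR.tendsto_cos_slope s).add hu
  have k2 := (hR.tendsto_cos_slope q).add hl
  rw [zero_add] at k1 k2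
  refine (k1.prodMk_nhds k2).congr fun t => ?_
  rw [Complex.coe_smul, waveBlock_apply]
  refine Prod.ext ?_ ?_
  · simp only [Prod.smul_fst, Prod.fst_sub, ← smul_add]
    congr 1; abel
  · simp only [Prod.smul_snd, Prod.snd_sub, ← smul_add]
    congr 1; abel

/-- In these coordinates the generator consists of the pairs `(p, y), (q, z)` with
`A R^(1/2) p = z` and `R^(1/2) q = y`, where the first equation is written by means of the
resolvent, `R^(1/2) p = R (R^(1/2) p - z)`, and one factor `R^(1/2)` is cancelled. -/
theorem isGroupGenerator_waveBlock : IsGroupGenerator (fun p q : H × H =>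
    p.1 = symbolCalc R (fun r => √r) (symbolCalc R (fun r => √r) p.1 - q.2) ∧
      symbolCalc R (fun r => √r) q.1 = p.2) (waveBlock R) := by
  set S := symbolCalc R fun r => √r with hS
  have hSS : ∀ x, S (S x) = R x := hR.sqrt_sqrt
  rintro ⟨p, y⟩ ⟨q, z⟩
  dsimp only
  constructor
  · rintro ⟨h1, rfl⟩
    have h := hR.tendsto_waveBlock (S p - z) q
    rw [← hS, ← h1] at h
    have e : R (S p - z) - (S p - z) = z := by
      rw [← hSS, ← h1]; abel
    rwa [e] at h
  · intro h
    -- `S` commutes with the group and maps everything into the range of `S`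
    have hc : Continuous fun w : H × H => (S w.1, S w.2) := by fun_prop
    have h1 := (hc.tendsto _).comp h
    have comm : ∀ {f}, IsSymbol f → ∀ x, S (symbolCalc R f x) = symbolCalc R f (S x) :=
      fun hf x => hR.symbolCalc_comm isSymbol_sqrt hf x
    have h2 := tendsto_nhds_unique (h1.congr fun t => ?_) (hR.tendsto_waveBlock p y)
    · rw [Prod.mk.injEq] at h2
      refine ⟨hR.sqrt_injective ?_, h2.1⟩
      have h3 : S z = R p - p := h2.2
      rw [← hS, hSS, map_sub, ← hSS z, h3, map_sub, ← hSS p, ← hSS (S p)]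
      abel
    · simp only [Function.comp_apply, waveBlock_apply, ← hS]
      refine Prod.ext ?_ ?_
      · simp [comm (isSymbol_cos t), comm (isSymbol_upper t)]
      · simp [comm (isSymbol_cos t), comm (isSymbol_lower t)]

end IsDensePosContraction

/-- Groups and their generators are transported by isomorphisms. -/
theorem IsC0Group.conj {X Y : Type*} [NormedAddCommGroup X] [NormedSpace ℂ X]
    [NormedAddCommGroup Y] [NormedSpace ℂ Y] {T : ℝ → X →L[ℂ] X} (hT : IsC0Group T)
    (e : X ≃L[ℂ] Y) :
    IsC0Group fun t => ((e : X →L[ℂ] Y).comp (T t)).comp (e.symm : Y →L[ℂ] X) where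
  zero := by ext y; simp [hT.zero]
  add t s y := by simp [hT.add]
  continuous y := e.continuous.comp (hT.continuous (e.symm y))

theorem IsGroupGenerator.conj {X Y : Type*} [NormedAddCommGroup X] [NormedSpace ℂ X]
    [NormedAddCommGroup Y] [NormedSpace ℂ Y] {T : ℝ → X →L[ℂ] X} {G : X → X → Prop}
    (hT : IsGroupGenerator G T) (e : X ≃L[ℂ] Y) :
    IsGroupGenerator (fun u v => G (e.symm u) (e.symm v))
      fun t => ((e : X →L[ℂ] Y).comp (T t)).comp (e.symm : Y →L[ℂ] X) := by
  intro u v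
  refine (hT _ _).trans ⟨?_, ?_⟩
  · intro h
    have := (e.continuous.tendsto _).comp h
    rw [e.apply_symm_apply] at this
    refine this.congr fun t => ?_
    simp
  · intro h
    have := (e.symm.continuous.tendsto _).comp h
    refine this.congr fun t => ?_
    simp

/-- If `R = (1 - B)⁻¹` and `W` is isomorphic to `H` in such a way that the inclusion of `W` into
`H` becomes `R^(1/2)`, then `(0 I; B 0)` generates a group on `W × H`. -/
theorem IsDensePosContraction.exists_group {R : H →L[ℂ] H} (hR : IsDensePosContraction R)
    {W : Type*} [NormedAddCommGroup W] [NormedSpace ℂ W] (U : H ≃L[ℂ] W) {ι : W →L[ℂ] H}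
    (hU : ∀ x, ι (U x) = symbolCalc R (fun r => √r) x) {B : H →ₗ.[ℂ] H}
    (hB : ∀ f g, (f, g) ∈ B.graph ↔ f = R (f - g)) :
    ∃ T : ℝ → (W × H) →L[ℂ] (W × H),
      IsC0Group T ∧ IsGroupGenerator (reductionMatrix ι B) T := by
  let e : (H × H) ≃L[ℂ] (W × H) := U.prodCongr (ContinuousLinearEquiv.refl ℂ H)
  refine ⟨_, hR.isC0Group_waveBlock.conj e, ?_⟩
  have h := hR.isGroupGenerator_waveBlock.conj e
  convert h using 3 with p q
  obtain ⟨p, y⟩ := p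
  obtain ⟨q, z⟩ := q
  obtain ⟨p, rfl⟩ := U.surjective p
  obtain ⟨q, rfl⟩ := U.surjective q
  have e1 : ∀ p y, e.symm (U p, y) = (p, y) := fun p y => by
    rw [ContinuousLinearEquiv.symm_apply_eq]; rfl
  rw [e1, e1]
  simp only [reductionMatrix, hU, hB]
  refine and_congr_left fun _ => ?_
  rw [← hR.sqrt_sqrt, hR.sqrt_injective.eq_iff]

end Groups

/-! ### Closed symmetric forms and their associated operators -/

section Forms

theorem inner_self_eq_ofReal {E : Type*} [NormedAddCommGroup E] [InnerProductSpace ℂ E] (x : E) :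
    (inner ℂ x x : ℂ) = ((‖x‖ ^ 2 : ℝ) : ℂ) := by
  rw [inner_self_eq_norm_sq_to_K]
  norm_cast

variable {H W : Type*} [NormedAddCommGroup H] [InnerProductSpace ℂ H]
  [NormedAddCommGroup W] [InnerProductSpace ℂ W] {ι : W →L[ℂ] H} {a : W → W → ℂ}

namespace IsClosedSymmetricForm

section Algebra

variable (h : IsClosedSymmetricForm ι a)
include h

theorem add_right (u v w : W) : a u (v + w) = a u v + a u w := by
  rw [h.symm, h.add_left, map_add, ← h.symm, ← h.symm]

theorem smul_right (z : ℂ) (u v : W) : a u (z • v) = conj z * a u v := by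
  rw [h.symm, h.smul_left, map_mul, ← h.symm]

theorem sub_left (u v w : W) : a (u - v) w = a u w - a v w := by
  have := h.add_left (u - v) v w
  rw [sub_add_cancel] at this
  rw [this, add_sub_cancel_right]

theorem coe_re (u : W) : ((a u u).re : ℂ) = a u u :=
  Complex.conj_eq_iff_re.1 (h.symm u u).symm

theorem sq_formNorm (u : W) : formNorm ι a u ^ 2 = (a u u).re + ‖ι u‖ ^ 2 :=
  Real.sq_sqrt (add_nonneg (h.nonneg u) (sq_nonneg _))

theorem norm_le_formNorm (u : W) : ‖ι u‖ ≤ formNorm ι a u :=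
  Real.le_sqrt_of_sq_le (le_add_of_nonneg_left (h.nonneg u))

/-- The solution of the variational problem `a(u, v) + (u, v) = (g, v)` is unique. -/
theorem solution_unique {u u' : W} {g : H}
    (hu : ∀ v, a u v + inner ℂ (ι v) (ι u) = inner ℂ (ι v) g)
    (hu' : ∀ v, a u' v + inner ℂ (ι v) (ι u') = inner ℂ (ι v) g) : u = u' := by
  have h1 := (hu (u - u')).trans (hu' (u - u')).symm
  have h2 : a (u - u') (u - u') + inner ℂ (ι (u - u')) (ι (u - u')) = 0 := by
    rw [h.sub_left]
    conv_lhs => rw [map_sub ι u u', inner_sub_right, ← map_sub]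
    linear_combination h1
  have h3 := congrArg Complex.re h2
  rw [Complex.add_re, inner_self_eq_ofReal] at h3
  have h3 : (a (u - u') (u - u')).re + ‖ι (u - u')‖ ^ 2 = 0 := by exact_mod_cast h3
  have h4 := h.norm_le_formNorm (u - u')
  rw [formNorm, h3, Real.sqrt_zero] at h4
  have h5 : ι (u - u') = ι 0 := by rw [map_zero, norm_le_zero_iff.1 h4]
  exact sub_eq_zero.1 (h.injective h5)

end Algebra

/-- The variational problem `a(u, v) + (u, v) = (g, v)` has a solution `u = J g` that depends
continuously on `g`, by the Lax-Milgram theorem; the solutions are dense in the form domain. -/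
theorem exists_solution [CompleteSpace H] [CompleteSpace W] (h : IsClosedSymmetricForm ι a)
    {k K : ℝ} (hk : 0 < k) (hkK : ∀ u, k * ‖u‖ ≤ formNorm ι a u ∧ formNorm ι a u ≤ K * ‖u‖) :
    ∃ J : H →L[ℂ] W, DenseRange J ∧
      ∀ g v, a (J g) v + inner ℂ (ι v) (ι (J g)) = inner ℂ (ι v) g := by
  obtain ⟨M, hM, hb⟩ := h.continuous
  let b₀ : W →ₗ⋆[ℂ] W →ₗ[ℂ] ℂ := LinearMap.mk₂'ₛₗ (starRingEnd ℂ) (RingHom.id ℂ)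
    (fun u v => a v u + inner ℂ (ι u) (ι v))
    (fun u v w => by simp only [h.add_right, map_add, inner_add_left]; ring)
    (fun z u v => by simp only [h.smul_right, map_smul, inner_smul_left, smul_eq_mul]; ring)
    (fun u v w => by simp only [h.add_left, map_add, inner_add_right]; ring)
    (fun z u v => by
      simp only [h.smul_left, map_smul, inner_smul_right, smul_eq_mul, RingHom.id_apply]; ring)
  have hb₀ : ∀ u v, ‖b₀ u v‖ ≤ (M * K * K + ‖ι‖ * ‖ι‖) * ‖u‖ * ‖v‖ := fun u v => by
    have h0 : ∀ u, 0 ≤ formNorm ι a u := fun u => Real.sqrt_nonneg _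
    have h1 : ‖a v u‖ ≤ M * (K * ‖v‖) * (K * ‖u‖) := (hb v u).trans
      (mul_le_mul (mul_le_mul_of_nonneg_left (hkK v).2 hM.le) (hkK u).2 (h0 u)
        (mul_nonneg hM.le ((h0 v).trans (hkK v).2)))
    have h2 : ‖(inner ℂ (ι u) (ι v) : ℂ)‖ ≤ ‖ι‖ * ‖u‖ * (‖ι‖ * ‖v‖) :=
      (norm_inner_le_norm _ _).trans (mul_le_mul (ι.le_opNorm u) (ι.le_opNorm v) (norm_nonneg _)
        (by positivity))
    calc _ ≤ _ := norm_add_le _ _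
      _ ≤ _ := add_le_add h1 h2
      _ = _ := by ring
  let T := InnerProductSpace.continuousLinearMapOfBilin (LinearMap.mkContinuous₂ b₀ _ hb₀)
  have hT : ∀ u v, inner ℂ (T u) v = a v u + inner ℂ (ι u) (ι v) := fun u v =>
    InnerProductSpace.continuousLinearMapOfBilin_apply _ u v
  have hunit : IsUnit T := by
    refine ContinuousLinearMap.isUnit_of_forall_le_norm_inner_map T (c := ⟨k ^ 2, sq_nonneg k⟩)
      (pow_pos hk 2) fun u => ?_
    have h1 : (inner ℂ (T u) u : ℂ) = ((formNorm ι a u ^ 2 : ℝ) : ℂ) := by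
      rw [hT, h.sq_formNorm, inner_self_eq_ofReal, Complex.ofReal_add, h.coe_re]
    rw [h1, Complex.norm_real, Real.norm_of_nonneg (sq_nonneg _)]
    have h2 := pow_le_pow_left₀ (by positivity) (hkK u).1 2
    calc ‖u‖ ^ 2 * k ^ 2 = (k * ‖u‖) ^ 2 := by ring
      _ ≤ _ := h2
  obtain ⟨S, hTS, hST⟩ := isUnit_iff_exists.1 hunit
  have hTS' : ∀ u, T (S u) = u := fun u => DFunLike.congr_fun hTS u
  have hST' : ∀ u, S (T u) = u := fun u => DFunLike.congr_fun hST u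
  -- `T u` represents the form, so the solution is `u = T⁻¹ ι* g`; `ι*` has dense range because `ι`
  -- is injective
  refine ⟨S.comp (ContinuousLinearMap.adjoint ι), ?_, fun g v => ?_⟩
  · have h1 : DenseRange (ContinuousLinearMap.adjoint ι) := by
      have h2 : (ContinuousLinearMap.adjoint ι).range.topologicalClosure = ⊤ := by
        rw [Submodule.topologicalClosure_eq_top_iff, Submodule.eq_bot_iff]
        intro v hv
        refine h.injective ?_
        rw [map_zero]
        refine ext_inner_left ℂ fun g => ?_
        rw [← ContinuousLinearMap.adjoint_inner_left, inner_zero_right]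
        exact hv _ ⟨g, rfl⟩
      exact (Submodule.dense_iff_topologicalClosure_eq_top).2 h2
    exact (Function.Surjective.denseRange fun u => ⟨T u, hST' u⟩).comp h1 S.continuous
  · have h1 := hT (S (ContinuousLinearMap.adjoint ι g)) v
    rw [hTS', ContinuousLinearMap.adjoint_inner_left] at h1
    have h2 := congrArg conj h1
    rw [inner_conj_symm, map_add, inner_conj_symm, ← h.symm] at h2
    exact h2.symm

end IsClosedSymmetricForm

section Solution

variable (h : IsClosedSymmetricForm ι a) {J : H →L[ℂ] W}
  (hJ : ∀ g v, a (J g) v + inner ℂ (ι v) (ι (J g)) = inner ℂ (ι v) g)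
include h hJ

/-- Take `v = J g` in the variational problem: `(R g, g)` is the square of a form norm. -/
theorem inner_solution (g : H) :
    (inner ℂ (ι (J g)) g : ℂ) = ((formNorm ι a (J g) ^ 2 : ℝ) : ℂ) := by
  rw [← hJ, h.sq_formNorm, inner_self_eq_ofReal, Complex.ofReal_add, h.coe_re]

/-- The operator `R = ι J` satisfies `0 ≤ R` because `(R g, g)` is a square, and `R ≤ 1` because
`‖R g‖² ≤ (R g, g)`. -/
theorem isDensePosContraction_solution [CompleteSpace H] (hd : DenseRange J) :
    IsDensePosContraction (ι.comp J) := by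
  have hle : ∀ g : H, ‖ι (J g)‖ ≤ ‖g‖ := fun g => by
    have h1 : (inner ℂ (ι (J g)) g : ℂ).re = formNorm ι a (J g) ^ 2 := by
      rw [inner_solution h hJ, Complex.ofReal_re]
    have h2 := (re_inner_le_norm (𝕜 := ℂ) (ι (J g)) g)
    have h3 := pow_le_pow_left₀ (norm_nonneg _) (h.norm_le_formNorm (J g)) 2
    rcases (norm_nonneg (ι (J g))).eq_or_lt with h0 | h0
    · rw [← h0]; exact norm_nonneg _
    · refine le_of_mul_le_mul_left ?_ h0
      rw [← sq]
      exact (h3.trans h1.ge).trans h2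
  refine ⟨?_, ?_, ?_⟩
  · rw [ContinuousLinearMap.nonneg_iff_isPositive, ContinuousLinearMap.isPositive_iff_complex]
    intro g
    rw [ContinuousLinearMap.comp_apply, inner_solution h hJ]
    simp only [Complex.ofReal_re, RCLike.re_to_complex]
    exact ⟨trivial, sq_nonneg _⟩
  · rw [ContinuousLinearMap.le_def, ContinuousLinearMap.isPositive_iff_complex]
    intro g
    have e : (inner ℂ ((1 - ι.comp J) g) g : ℂ)
        = ((‖g‖ ^ 2 - formNorm ι a (J g) ^ 2 : ℝ) : ℂ) := by
      rw [sub_apply, inner_sub_left, ContinuousLinearMap.comp_apply, inner_solution h hJ,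
        one_apply_eq_self, inner_self_eq_ofReal]
      push_cast
      rfl
    rw [e]
    simp only [Complex.ofReal_re, RCLike.re_to_complex]
    refine ⟨trivial, sub_nonneg.2 ?_⟩
    have h1 : (inner ℂ (ι (J g)) g : ℂ).re = formNorm ι a (J g) ^ 2 := by
      rw [inner_solution h hJ, Complex.ofReal_re]
    rw [← h1, sq]
    exact (re_inner_le_norm (𝕜 := ℂ) (ι (J g)) g).trans
      (mul_le_mul_of_nonneg_right (hle g) (norm_nonneg _))
  · exact h.dense.comp hd ι.continuous

/-- The graph of the operator associated with `a` in terms of the resolvent `R = ι J` at `1`. -/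
theorem IsAssociatedOperator.mem_graph_iff {B : H →ₗ.[ℂ] H} (hB : IsAssociatedOperator ι a B)
    (f g : H) : (f, g) ∈ B.graph ↔ f = ι (J (f - g)) := by
  have h1 := hB f (-g)
  rw [neg_neg] at h1
  rw [h1]
  constructor
  · rintro ⟨u, rfl, hu⟩
    refine congrArg ι (h.solution_unique (fun v => ?_) (hJ (ι u - g)))
    rw [hu, inner_sub_right, inner_neg_right]
    ring
  · intro hf
    refine ⟨J (f - g), hf.symm, fun v => ?_⟩
    have h2 := hJ (f - g) v
    rw [← hf, inner_sub_right] at h2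
    rw [inner_neg_right]
    linear_combination h2

/-- The form domain is isomorphic to `H` in such a way that the inclusion into `H` becomes the
square root of the resolvent `R = ι J`: since `‖√R g‖` is the form norm of `J g`, the map
`√R g ↦ J g` and its inverse are bounded between dense subspaces and extend by continuity. -/
theorem exists_equiv_formDomain [CompleteSpace H] [CompleteSpace W] (hd : DenseRange J)
    {k K : ℝ} (hk : 0 < k) (hkK : ∀ u, k * ‖u‖ ≤ formNorm ι a u ∧ formNorm ι a u ≤ K * ‖u‖) :
    ∃ U : H ≃L[ℂ] W, ∀ x, ι (U x) = symbolCalc (ι.comp J) (fun r => √r) x := by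
  have hR := isDensePosContraction_solution h hJ hd
  set S := symbolCalc (ι.comp J) (fun r => √r) with hS
  have hSsa : IsSelfAdjoint S := by
    rw [hS, hR.symbolCalc_eq_cfc Real.continuous_sqrt.continuousOn]
    exact cfc_predicate _ _
  have hSS : ∀ x, S (S x) = ι (J x) := hR.sqrt_sqrt
  have hnorm : ∀ g, ‖S g‖ = formNorm ι a (J g) := fun g => by
    have h1 : (inner ℂ (S (S g)) g : ℂ) = inner ℂ (S g) (S g) := by
      rw [← ContinuousLinearMap.adjoint_inner_right, ← ContinuousLinearMap.star_eq_adjoint,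
        hSsa.star_eq]
    rw [hSS, inner_solution h hJ, inner_self_eq_ofReal] at h1
    have h2 : formNorm ι a (J g) ^ 2 = ‖S g‖ ^ 2 := by exact_mod_cast h1
    exact ((pow_left_inj₀ (Real.sqrt_nonneg _) (norm_nonneg _) two_ne_zero).1 h2).symm
  have hSd : DenseRange S := by
    have h1 : DenseRange fun x => S (S x) := by
      have := hR.dense
      exact (funext hSS : (fun x => S (S x)) = _) ▸ this
    exact h1.mono (by rintro _ ⟨x, rfl⟩; exact ⟨S x, rfl⟩)
  have b1 : ∀ x, ‖J x‖ ≤ k⁻¹ * ‖S x‖ := fun x => by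
    rw [hnorm, inv_mul_eq_div, le_div_iff₀ hk, mul_comm]
    exact (hkK _).1
  have b2 : ∀ x, ‖S x‖ ≤ K * ‖J x‖ := fun x => by
    rw [hnorm]
    exact (hkK _).2
  let U : H →L[ℂ] W := LinearMap.extendOfNorm J.toLinearMap S.toLinearMap
  let U' : W →L[ℂ] H := LinearMap.extendOfNorm S.toLinearMap J.toLinearMap
  have hU : ∀ x, U (S x) = J x := fun x =>
    LinearMap.extendOfNorm_eq (e := S.toLinearMap) hSd ⟨_, b1⟩ x
  have hU' : ∀ x, U' (J x) = S x := fun x =>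
    LinearMap.extendOfNorm_eq (e := J.toLinearMap) hd ⟨_, b2⟩ x
  have e1 : U'.comp U = .id ℂ H := clm_ext_of_denseRange hSd fun x => by simp [hU, hU']
  have e2 : U.comp U' = .id ℂ W := clm_ext_of_denseRange hd fun x => by simp [hU, hU']
  refine ⟨.equivOfInverse U U' (fun x => DFunLike.congr_fun e1 x)
    (fun x => DFunLike.congr_fun e2 x), fun x => ?_⟩
  have e3 : ι.comp U = S := clm_ext_of_denseRange hSd fun x => by simp [hU, hSS]
  exact DFunLike.congr_fun e3 x

end Solution

/-- An operator with bounded self-adjoint resolvent at `1` is self-adjoint. -/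
theorem isSelfAdjoint_of_resolvent [CompleteSpace H] {R : H →L[ℂ] H}
    (hR : IsDensePosContraction R) {B : H →ₗ.[ℂ] H}
    (hB : ∀ f g, (f, g) ∈ B.graph ↔ f = R (f - g)) : IsSelfAdjoint B := by
  have hmem : ∀ y, (R y, R y - y) ∈ B.graph := fun y => by rw [hB, sub_sub_cancel]
  have hsa : ∀ x y : H, (inner ℂ (R x) y : ℂ) = inner ℂ x (R y) := fun x y => by
    rw [← ContinuousLinearMap.adjoint_inner_right, ← ContinuousLinearMap.star_eq_adjoint,
      hR.isSelfAdjoint.star_eq]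
  have hdense : Dense (B.domain : Set H) := hR.dense.mono (by
    rintro _ ⟨y, rfl⟩
    exact LinearPMap.mem_domain_of_mem_graph (hmem y))
  rw [LinearPMap.isSelfAdjoint_def]
  refine LinearPMap.eq_of_eq_graph ?_
  rw [LinearPMap.adjoint_graph_eq_graph_adjoint hdense]
  ext ⟨f, g⟩
  rw [Submodule.mem_adjoint_iff, hB]
  constructor
  · intro hfg
    refine ext_inner_left ℂ fun y => ?_
    have h1 := hfg _ _ (hmem y)
    simp only [inner_sub_left, hsa] at h1
    rw [map_sub, inner_sub_right]
    linear_combination -h1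
  · intro hf x y hxy
    rw [hB] at hxy
    -- with `z = x - y` and `w = f - g` both sides are expressed by `R`
    have e1 : y = R (x - y) - (x - y) := by rw [← hxy]; abel
    have e2 : g = R (f - g) - (f - g) := by rw [← hf]; abel
    generalize x - y = z at *
    generalize f - g = w at *
    subst hxy hf e1 e2
    simp only [inner_sub_left, hsa, map_sub, inner_sub_right]
    ring

/-- `(B u, u) = -a(u, u)`. -/
theorem IsAssociatedOperator.isDissipative (h : IsClosedSymmetricForm ι a)
    {B : H →ₗ.[ℂ] H} (hB : IsAssociatedOperator ι a B) : IsDissipative B := by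
  intro f
  have h1 := hB f (-B f)
  rw [neg_neg] at h1
  obtain ⟨u, hu, hu'⟩ := h1.1 (B.mem_graph f)
  have h2 := hu' u
  rw [hu, inner_neg_right] at h2
  have h3 := h.nonneg u
  rw [h2, Complex.neg_re, ← inner_conj_symm, Complex.conj_re] at h3
  linarith

/-- The operator associated with a closed symmetric positive form is self-adjoint and dissipative
and generates a cosine function, whose phase space is `W × H`. -/
theorem IsAssociatedOperator.generation [CompleteSpace H] [CompleteSpace W]
    (h : IsClosedSymmetricForm ι a)
    (hequiv : ∃ k > 0, ∃ K > 0, ∀ u : W,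
      k * ‖u‖ ≤ formNorm ι a u ∧ formNorm ι a u ≤ K * ‖u‖)
    {B : H →ₗ.[ℂ] H} (hB : IsAssociatedOperator ι a B) :
    IsSelfAdjoint B ∧ IsDissipative B ∧
    (∃ C : ℝ → H →L[ℂ] H, IsCosineFunction C ∧ IsCosineGenerator B C) ∧ IsPhaseSpace ι B := by
  obtain ⟨k, hk, K, -, hkK⟩ := hequiv
  obtain ⟨J, hd, hJ⟩ := h.exists_solution hk hkK
  have hR := isDensePosContraction_solution h hJ hd
  have hgraph : ∀ f g, (f, g) ∈ B.graph ↔ f = ι.comp J (f - g) := hB.mem_graph_iff h hJ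
  obtain ⟨U, hU⟩ := exists_equiv_formDomain h hJ hd hk hkK
  refine ⟨isSelfAdjoint_of_resolvent hR hgraph, hB.isDissipative h,
    ⟨_, hR.isCosineFunction, hR.isCosineGenerator hgraph⟩, ‹_›, h.injective, fun f hf => ?_,
    ⟨‖J‖, fun u g hu => ?_⟩, hR.exists_group U hU hgraph⟩
  · exact ⟨_, ((hgraph f _).1 (B.mem_graph ⟨f, hf⟩)).symm⟩
  · have h1 : u = J (ι u - g) := h.injective ((hgraph _ _).1 hu)
    calc ‖u‖ = ‖J (ι u - g)‖ := by rw [← h1]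
      _ ≤ ‖J‖ * ‖ι u - g‖ := J.le_opNorm _
      _ ≤ ‖J‖ * (‖ι u‖ + ‖g‖) := by gcongr; exact norm_sub_le _ _

end Forms

/-! ### Weak derivatives, continuous representatives and integration by parts -/

section WeakDerivatives

theorem IsContRep.integrableOn {F f : ℝ → ℂ} (hF : IsContRep F f) : IntegrableOn f (Ioo 0 1) :=
  (hF.1.integrableOn_Icc.mono_set Ioo_subset_Icc_self).congr_fun_ae hF.2.symm

theorem IsContRep.integrableOn_mul {F f g : ℝ → ℂ} (hF : IsContRep F f)
    (hg : IntegrableOn g (Ioo 0 1)) : IntegrableOn (fun x => f x * g x) (Ioo 0 1) := by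
  obtain ⟨K, hK⟩ := isCompact_Icc.exists_bound_of_continuousOn hF.1
  refine hg.bdd_mul (c := K) hF.integrableOn.1 ?_
  filter_upwards [hF.2, ae_restrict_mem measurableSet_Ioo] with x hx hx2
  rw [hx]
  exact hK x (Ioo_subset_Icc_self hx2)

theorem HasWeakDeriv.conj {f g : ℝ → ℂ} (h : HasWeakDeriv f g) (hf : IntegrableOn f (Ioo 0 1))
    (hg : IntegrableOn g (Ioo 0 1)) :
    HasWeakDeriv (fun x => conj (f x)) (fun x => conj (g x)) :=
  h.clm hf hg (Complex.conjCLE : ℂ →L[ℝ] ℂ)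

theorem IsContRep.conj {F f : ℝ → ℂ} (hF : IsContRep F f) :
    IsContRep (fun x => conj (F x)) (fun x => conj (f x)) :=
  ⟨Complex.continuous_conj.comp_continuousOn hF.1, by
    filter_upwards [hF.2] with x hx; rw [hx]⟩

/-- The fundamental theorem of calculus for weak derivatives. -/
theorem HasWeakDeriv.integral_eq_sub {f g F : ℝ → ℂ} (h : HasWeakDeriv f g)
    (hF : IsContRep F f) (hg : IntegrableOn g (Ioo 0 1)) :
    ∫ x in Ioo (0 : ℝ) 1, g x = F 1 - F 0 := by
  have hf := hF.integrableOn
  -- the real and the imaginary part are absolutely continuous, up to a null set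
  have key : ∀ L : ℂ →L[ℝ] ℝ, ∫ x in Ioo (0 : ℝ) 1, L (g x) = L (F 1) - L (F 0) := fun L => by
    obtain ⟨G, hG, hGd, hGe⟩ := (h.clm hf hg L).exists_ac (L.integrable_comp hf)
      (L.integrable_comp hg)
    have hGc := hG.continuousOn
    rw [uIcc_of_le zero_le_one] at hGc
    have e : EqOn (fun x => L (F x)) G (Icc 0 1) := by
      refine Measure.eqOn_Icc_of_ae_eq volume zero_ne_one ?_ (L.continuous.comp_continuousOn hF.1)
        hGc
      rw [Measure.restrict_congr_set Ioo_ae_eq_Icc.symm]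
      filter_upwards [hF.2, hGe] with x h1 h2
      rw [← h1, ← h2]
    have e1 : L (F 1) = G 1 := e (by simp)
    have e0 : L (F 0) = G 0 := e (by simp)
    rw [e1, e0, ← hG.integral_deriv_eq_sub, intervalIntegral.integral_of_le zero_le_one,
      integral_Ioc_eq_integral_Ioo]
    refine integral_congr_ae ?_
    filter_upwards [ae_restrict_of_ae hGd, ae_restrict_mem measurableSet_Ioo] with x hx hx2
    rw [(hx (by rw [uIcc_of_le zero_le_one]; exact Ioo_subset_Icc_self hx2)).deriv]
  apply Complex.ext
  · have e := Complex.reCLM.integral_comp_comm hg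
    rw [key] at e
    simpa using e.symm
  · have e := Complex.imCLM.integral_comp_comm hg
    rw [key] at e
    simpa using e.symm

/-- Product rule for weak derivatives of complex functions. -/
theorem HasWeakDeriv.mul {f f' g g' F G : ℝ → ℂ} (hf : HasWeakDeriv f f') (hg : HasWeakDeriv g g')
    (hF : IsContRep F f) (hG : IsContRep G g) (hf' : IntegrableOn f' (Ioo 0 1))
    (hg' : IntegrableOn g' (Ioo 0 1)) :
    HasWeakDeriv (fun x => f x * g x) (fun x => f' x * g x + f x * g' x) := by
  have hfi := hF.integrableOn
  have hgi := hG.integrableOn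
  -- the real and the imaginary part of `f` are treated separately
  have key : ∀ L : ℂ →L[ℝ] ℝ,
      HasWeakDeriv (fun x => (L (f x) : ℂ) * g x)
        (fun x => (L (f' x) : ℂ) * g x + (L (f x) : ℂ) * g' x) ∧
      IntegrableOn (fun x => (L (f x) : ℂ) * g x) (Ioo 0 1) ∧
      IntegrableOn (fun x => (L (f' x) : ℂ) * g x + (L (f x) : ℂ) * g' x) (Ioo 0 1) := fun L => by
    have hLF : IsContRep (fun x => (L (F x) : ℂ)) (fun x => (L (f x) : ℂ)) :=
      ⟨Complex.continuous_ofReal.comp_continuousOn (L.continuous.comp_continuousOn hF.1), by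
        filter_upwards [hF.2] with x hx; rw [hx]⟩
    have i1 := hLF.integrableOn_mul hgi
    have i2 : IntegrableOn (fun x => (L (f' x) : ℂ) * g x) (Ioo 0 1) := by
      have := hG.integrableOn_mul (g := fun x => (L (f' x) : ℂ))
        (Complex.ofRealCLM.integrable_comp (L.integrable_comp hf'))
      simpa only [mul_comm] using this
    have i3 := i2.add (hLF.integrableOn_mul hg')
    exact ⟨(hf.clm hfi hf' L).ofReal_mul hg (L.integrable_comp hfi) (L.integrable_comp hf')
      hgi hg' i1 i3, i1, i3⟩
  obtain ⟨h1, i1, j1⟩ := key Complex.reCLM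
  obtain ⟨h2, i2, j2⟩ := key Complex.imCLM
  have h3 := h1.add (h2.const_mul Complex.I) i1 j1 (i2.const_mul _) (j2.const_mul _)
  refine h3.congr (ae_of_all _ fun x => ?_) (ae_of_all _ fun x => ?_)
  · have e := Complex.re_add_im (f x)
    simp only [Complex.reCLM_apply, Complex.imCLM_apply]
    linear_combination (g x) * e
  · have e := Complex.re_add_im (f x)
    have e' := Complex.re_add_im (f' x)
    simp only [Complex.reCLM_apply, Complex.imCLM_apply]
    linear_combination (g x) * e' + (g' x) * e

theorem IsContRep.mul {F G f g : ℝ → ℂ} (hF : IsContRep F f) (hG : IsContRep G g) :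
    IsContRep (fun x => F x * G x) (fun x => f x * g x) :=
  ⟨hF.1.mul hG.1, by filter_upwards [hF.2, hG.2] with x h1 h2; rw [h1, h2]⟩

/-- Integration by parts. -/
theorem HasWeakDeriv.integral_mul_conj {f f' g g' F G : ℝ → ℂ} (hf : HasWeakDeriv f f')
    (hg : HasWeakDeriv g g') (hF : IsContRep F f) (hG : IsContRep G g)
    (hf' : IntegrableOn f' (Ioo 0 1)) (hg' : IntegrableOn g' (Ioo 0 1)) :
    ∫ x in Ioo (0 : ℝ) 1, f x * conj (g' x) = F 1 * conj (G 1) - F 0 * conj (G 0)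
      - ∫ x in Ioo (0 : ℝ) 1, f' x * conj (g x) := by
  have hgc' : IntegrableOn (fun x => conj (g' x)) (Ioo 0 1) :=
    (Complex.conjCLE : ℂ →L[ℝ] ℂ).integrable_comp hg'
  have i1 : IntegrableOn (fun x => f' x * conj (g x)) (Ioo 0 1) := by
    simpa only [mul_comm] using hG.conj.integrableOn_mul hf'
  have i2 := hF.integrableOn_mul hgc'
  have h := (hf.mul (hg.conj hG.integrableOn hg') hF hG.conj hf' hgc').integral_eq_sub
    (hF.mul hG.conj) (i1.add i2)
  rw [integral_add i1 i2] at h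
  linear_combination h

theorem hasWeakDeriv_ofReal {φ : ℝ → ℝ} (hφ : ContDiff ℝ 1 φ) :
    HasWeakDeriv (fun x => ((φ x : ℝ) : ℂ)) (fun x => ((deriv φ x : ℝ) : ℂ)) := by
  have h1 : HasWeakDeriv φ (deriv φ) := hasWeakDeriv_of_ac
    (ContDiffOn.absolutelyContinuousOnInterval hφ.contDiffOn)
    (ae_of_all _ fun x _ => (hφ.differentiable one_ne_zero x).hasDerivAt)
  have hi : ∀ {ψ : ℝ → ℝ}, Continuous ψ → IntegrableOn ψ (Ioo 0 1) := fun h =>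
    h.integrableOn_Icc.mono_set Ioo_subset_Icc_self
  exact h1.clm (hi hφ.continuous) (hi (hφ.continuous_deriv le_rfl)) Complex.ofRealCLM

theorem isContRep_of_continuous {F : ℝ → ℂ} (hF : Continuous F) : IsContRep F F :=
  ⟨hF.continuousOn, .rfl⟩

theorem hasWeakDeriv_affine (a b : ℂ) :
    HasWeakDeriv (fun x : ℝ => a + b * (x : ℂ)) (fun _ => b) := by
  have h1 := (hasWeakDeriv_ofReal contDiff_id).const_mul b
  have h2 := (hasWeakDeriv_ofReal (contDiff_const (c := (1 : ℝ)))).const_mul a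
  have i : ∀ {F : ℝ → ℂ}, Continuous F → IntegrableOn F (Ioo 0 1) := fun hF =>
    (isContRep_of_continuous hF).integrableOn
  have h := h2.add h1 (i (by fun_prop)) (i (by simp [continuous_const])) (i (by simp; fun_prop))
    (i (by simp [continuous_const]))
  exact h.congr (ae_of_all _ fun x => by simp) (ae_of_all _ fun x => by simp)

/-- The value at `0` in terms of integrals: the integral of the derivative of `(1 - x) f(x)`. -/
theorem HasWeakDeriv.apply_zero_eq {f f' F : ℝ → ℂ} (h : HasWeakDeriv f f') (hF : IsContRep F f)
    (hf' : IntegrableOn f' (Ioo 0 1)) : F 0 = (∫ x in Ioo (0 : ℝ) 1, f x)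
      - ∫ x in Ioo (0 : ℝ) 1, (1 + -1 * (x : ℂ)) * f' x := by
  have hc : IsContRep (fun x : ℝ => (1 + -1 * (x : ℂ))) (fun x : ℝ => (1 + -1 * (x : ℂ))) :=
    isContRep_of_continuous (by fun_prop)
  have i1 := hc.integrableOn_mul hf'
  have i2 : IntegrableOn (fun x => (-1 : ℂ) * f x) (Ioo 0 1) := hF.integrableOn.const_mul _
  have e := ((hasWeakDeriv_affine 1 (-1)).mul h hc hF
    (isContRep_of_continuous continuous_const).integrableOn hf').integral_eq_sub
    (hc.mul hF) (i2.add i1)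
  rw [integral_add i2 i1, integral_const_mul] at e
  push_cast at e
  linear_combination e

/-- The value at `1` in terms of integrals: the integral of the derivative of `x f(x)`. -/
theorem HasWeakDeriv.apply_one_eq {f f' F : ℝ → ℂ} (h : HasWeakDeriv f f') (hF : IsContRep F f)
    (hf' : IntegrableOn f' (Ioo 0 1)) : F 1 = (∫ x in Ioo (0 : ℝ) 1, f x)
      + ∫ x in Ioo (0 : ℝ) 1, (0 + 1 * (x : ℂ)) * f' x := by
  have hc : IsContRep (fun x : ℝ => (0 + 1 * (x : ℂ))) (fun x : ℝ => (0 + 1 * (x : ℂ))) :=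
    isContRep_of_continuous (by fun_prop)
  have i1 := hc.integrableOn_mul hf'
  have i2 : IntegrableOn (fun x => (1 : ℂ) * f x) (Ioo 0 1) := hF.integrableOn.const_mul _
  have e := ((hasWeakDeriv_affine 0 1).mul h hc hF
    (isContRep_of_continuous continuous_const).integrableOn hf').integral_eq_sub
    (hc.mul hF) (i2.add i1)
  rw [integral_add i2 i1, integral_const_mul] at e
  push_cast at e
  linear_combination -e

/-- Functions that are absolutely continuous and bounded away from zero have absolutely continuous
reciprocals. -/
theorem absolutelyContinuousOnInterval_inv {f : ℝ → ℝ} {a b k : ℝ}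
    (hf : AbsolutelyContinuousOnInterval f a b) (hk : 0 < k) (hfk : ∀ x ∈ uIcc a b, k ≤ f x) :
    AbsolutelyContinuousOnInterval (fun x => (f x)⁻¹) a b := by
  have hf' := Tendsto.const_mul (k⁻¹ * k⁻¹) hf
  rw [mul_zero] at hf'
  refine squeeze_zero' (Eventually.of_forall fun _ => Finset.sum_nonneg fun i _ => dist_nonneg)
    ?_ hf'
  rw [eventually_inf_principal]
  refine Eventually.of_forall fun E hE => ?_
  rw [Finset.mul_sum]
  refine Finset.sum_le_sum fun i hi => ?_
  have h1 := hfk _ (hE.1 i hi).1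
  have h2 := hfk _ (hE.1 i hi).2
  have p1 := hk.trans_le h1
  have p2 := hk.trans_le h2
  rw [dist_inv_inv₀ p1.ne' p2.ne', Real.norm_of_nonneg p1.le, Real.norm_of_nonneg p2.le,
    div_eq_inv_mul, mul_inv]
  gcongr

/-- Reciprocals of positive functions have weak derivatives. -/
theorem HasWeakDeriv.inv_of_pos {c c' : ℝ → ℝ} (h : HasWeakDeriv c c')
    (hc : ContinuousOn c (Icc 0 1)) (hc' : IntegrableOn c' (Ioo 0 1)) {k : ℝ} (hk : 0 < k)
    (hck : ∀ x ∈ Icc (0 : ℝ) 1, k ≤ c x) :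
    HasWeakDeriv (fun x => (c x)⁻¹) (fun x => -c' x / c x ^ 2) := by
  obtain ⟨K, hK, hKd, hKe⟩ := h.exists_ac (hc.integrableOn_Icc.mono_set Ioo_subset_Icc_self) hc'
  have hKc := hK.continuousOn
  rw [uIcc_of_le zero_le_one] at hKc
  have e : EqOn c K (Icc 0 1) := by
    refine Measure.eqOn_Icc_of_ae_eq volume zero_ne_one ?_ hc hKc
    rwa [Measure.restrict_congr_set Ioo_ae_eq_Icc.symm]
  have hKk : ∀ x ∈ uIcc (0 : ℝ) 1, k ≤ K x := fun x hx => by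
    rw [uIcc_of_le zero_le_one] at hx
    rw [← e hx]
    exact hck x hx
  have h1 := hasWeakDeriv_of_ac (a := fun x => -c' x / K x ^ 2)
    (absolutelyContinuousOnInterval_inv hK hk hKk) (by
      filter_upwards [hKd] with x hx hx2
      exact (hx hx2).fun_inv (hk.trans_le (hKk x hx2)).ne')
  refine h1.congr ?_ ?_ <;>
    filter_upwards [ae_restrict_mem measurableSet_Ioo] with x hx <;>
    rw [e (Ioo_subset_Icc_self hx)]

/-- If `c f ∈ H¹(0,1)` with `0 < c ∈ H¹(0,1)`, then `f ∈ H¹(0,1)`, by the product rule for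
`c⁻¹ (c f)`. -/
theorem HasWeakDeriv.exists_of_mul {c c' : ℝ → ℝ} {f p : ℝ → ℂ} (h : HasWeakDeriv c c')
    (hc : ContinuousOn c (Icc 0 1)) (hc' : MemLp c' 2 (volume.restrict (Ioo 0 1)))
    (hpos : ∀ x ∈ Icc (0 : ℝ) 1, 0 < c x)
    (hf : MemLp f 2 (volume.restrict (Ioo 0 1))) (hp : MemLp p 2 (volume.restrict (Ioo 0 1)))
    (hw : HasWeakDeriv (fun x => (c x : ℂ) * f x) p) :
    ∃ g, MemLp g 2 (volume.restrict (Ioo (0 : ℝ) 1)) ∧ HasWeakDeriv f g := by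
  have hinv : ContinuousOn (fun x => (c x)⁻¹) (Icc 0 1) := hc.inv₀ fun x hx => (hpos x hx).ne'
  obtain ⟨k, hk, hck⟩ : ∃ k : ℝ, 0 < k ∧ ∀ x ∈ Icc (0 : ℝ) 1, k ≤ c x := by
    obtain ⟨x, hx, hmin⟩ := isCompact_Icc.exists_isMinOn ⟨0, by simp⟩ hc
    exact ⟨c x, hpos x hx, hmin⟩
  have hfi : IntegrableOn f (Ioo 0 1) := hf.integrable (by norm_num)
  have hc'i : IntegrableOn c' (Ioo 0 1) := hc'.integrable (by norm_num)
  have hpi : IntegrableOn p (Ioo 0 1) := hp.integrable (by norm_num)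
  have hcC : IsContRep (fun x => (c x : ℂ)) (fun x => (c x : ℂ)) :=
    ⟨Complex.continuous_ofReal.comp_continuousOn hc, .rfl⟩
  have hcf := hcC.integrableOn_mul hfi
  obtain ⟨P, hP⟩ := hw.exists_isContRep hcf hpi
  obtain ⟨M, hM⟩ := isCompact_Icc.exists_bound_of_continuousOn hP.1
  have hiw := h.inv_of_pos hc hc'i hk hck
  have hi0 : IntegrableOn (fun x => (c x)⁻¹) (Ioo 0 1) :=
    hinv.integrableOn_Icc.mono_set Ioo_subset_Icc_self
  have hsq : ContinuousOn (fun x => (c x ^ 2)⁻¹) (Icc 0 1) :=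
    (hc.pow 2).inv₀ fun x hx => (pow_pos (hpos x hx) 2).ne'
  obtain ⟨L, hL⟩ := isCompact_Icc.exists_bound_of_continuousOn hsq
  obtain ⟨L', hL'⟩ := isCompact_Icc.exists_bound_of_continuousOn hinv
  have m0 : MemLp (fun x => -c' x / c x ^ 2) 2 (volume.restrict (Ioo (0 : ℝ) 1)) := by
    refine hc'.of_le_mul (c := L) ?_ ?_
    · simp only [div_eq_mul_inv]
      exact hc'.1.neg.mul ((hsq.mono Ioo_subset_Icc_self).aestronglyMeasurable measurableSet_Ioo)
    · filter_upwards [ae_restrict_mem measurableSet_Ioo] with x hx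
      rw [div_eq_mul_inv, norm_mul, norm_neg, mul_comm]
      exact mul_le_mul_of_nonneg_right (hL x (Ioo_subset_Icc_self hx)) (norm_nonneg _)
  have m1 : MemLp (fun x => ((-c' x / c x ^ 2 : ℝ) : ℂ) * ((c x : ℂ) * f x)) 2
      (volume.restrict (Ioo (0 : ℝ) 1)) := by
    refine m0.of_le_mul (c := M) ?_ ?_
    · exact (Complex.continuous_ofReal.comp_aestronglyMeasurable m0.1).mul hcf.1
    · filter_upwards [hP.2, ae_restrict_mem measurableSet_Ioo] with x hx hx2
      rw [norm_mul, Complex.norm_real, hx, mul_comm]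
      exact mul_le_mul_of_nonneg_right (hM x (Ioo_subset_Icc_self hx2)) (norm_nonneg _)
  have m2 : MemLp (fun x => (((c x)⁻¹ : ℝ) : ℂ) * p x) 2 (volume.restrict (Ioo (0 : ℝ) 1)) := by
    refine hp.of_le_mul (c := L') ?_ ?_
    · exact ((Complex.continuous_ofReal.comp_continuousOn
        (hinv.mono Ioo_subset_Icc_self)).aestronglyMeasurable measurableSet_Ioo).mul hp.1
    · filter_upwards [ae_restrict_mem measurableSet_Ioo] with x hx
      rw [norm_mul, Complex.norm_real]
      exact mul_le_mul_of_nonneg_right (hL' x (Ioo_subset_Icc_self hx)) (norm_nonneg _)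
  have e : (fun x => (((c x)⁻¹ : ℝ) : ℂ) * ((c x : ℂ) * f x))
      =ᵐ[volume.restrict (Ioo (0 : ℝ) 1)] f := by
    filter_upwards [ae_restrict_mem measurableSet_Ioo] with x hx
    have : (c x : ℂ) ≠ 0 := Complex.ofReal_ne_zero.2 (hpos x (Ioo_subset_Icc_self hx)).ne'
    rw [Complex.ofReal_inv, inv_mul_cancel_left₀ this]
  exact ⟨_, m1.add m2, (hiw.ofReal_mul hw hi0 (m0.integrable (by norm_num)) hcf hpi
    (Integrable.congr hfi e.symm) ((m1.add m2).integrable (by norm_num))).congr e .rfl⟩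

end WeakDerivatives

/-! ### Completeness of the form domain -/

namespace Network

variable {n m : ℕ} {N : Network n m}

theorem integral_edgeMeasure (j : Fin m) (F : ℝ → ℂ) :
    ∫ x, F x ∂(N.edgeMeasure j) = (N.μ j : ℂ) * ∫ x in Ioo (0 : ℝ) 1, F x := by
  rw [edgeMeasure, integral_smul_measure, ENNReal.toReal_ofReal (N.μ_pos j).le, Complex.real_smul]

theorem inner_X2 (f g : N.X2) : (inner ℂ f g : ℂ)
    = ∑ j, (N.μ j : ℂ) * ∫ x in Ioo (0 : ℝ) 1, g j x * conj (f j x) := by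
  rw [PiLp.inner_apply]
  refine Finset.sum_congr rfl fun j _ => ?_
  rw [L2.inner_def, ← integral_edgeMeasure]
  rfl

theorem norm_sq_X2 (f : N.X2) : ‖f‖ ^ 2 = ∑ j, N.μ j * ∫ x in Ioo (0 : ℝ) 1, ‖f j x‖ ^ 2 := by
  have h : ((‖f‖ ^ 2 : ℝ) : ℂ) = _ := (inner_self_eq_ofReal f).symm.trans (inner_X2 f f)
  have e : ∀ j x, f j x * conj (f j x) = ((‖f j x‖ ^ 2 : ℝ) : ℂ) := fun j x => by
    rw [Complex.mul_conj, Complex.normSq_eq_norm_sq]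
  simp only [e, integral_complex_ofReal] at h
  exact_mod_cast h

/-- Integration against a continuous function is continuous on `X₂`. -/
theorem continuous_integral_mul {ψ : ℝ → ℂ} (hψ : Continuous ψ) (j : Fin m) :
    Continuous fun f : N.X2 => ∫ x in Ioo (0 : ℝ) 1, ψ x * f j x := by
  have hL : MemLp (fun x => conj (ψ x)) 2 (N.edgeMeasure j) := by
    rw [memLp_edge_iff]
    obtain ⟨K, hK⟩ := (isCompact_Icc (a := (0 : ℝ)) (b := 1)).exists_bound_of_continuousOn
      (Complex.continuous_conj.comp hψ).continuousOn
    refine MemLp.of_bound (Complex.continuous_conj.comp hψ).aestronglyMeasurable K ?_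
    filter_upwards [ae_restrict_mem measurableSet_Ioo] with x hx
    exact hK x (Ioo_subset_Icc_self hx)
  have e : ∀ f : N.X2, ∫ x in Ioo (0 : ℝ) 1, ψ x * f j x
      = (N.μ j : ℂ)⁻¹ * inner ℂ (hL.toLp _) (f j) := fun f => by
    rw [L2.inner_def, eq_inv_mul_iff_mul_eq₀ (Complex.ofReal_ne_zero.2 (N.μ_pos j).ne'),
      ← integral_edgeMeasure]
    refine integral_congr_ae ?_
    filter_upwards [hL.coeFn_toLp] with x hx
    rw [RCLike.inner_apply, hx, Complex.conj_conj, mul_comm]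
  simp only [e]
  exact continuous_const.mul (continuous_const.inner (PiLp.continuous_apply 2 _ j))

/-- The graph of the weak derivative is closed. -/
theorem isClosed_isWeakDeriv :
    IsClosed {u : WithLp 2 (N.X2 × N.X2) | IsWeakDeriv u.fst u.snd} := by
  have e : {u : WithLp 2 (N.X2 × N.X2) | IsWeakDeriv u.fst u.snd}
      = ⋂ j, ⋂ φ, ⋂ (_ : IsTestFunction φ), {u |
        ∫ x in Ioo (0 : ℝ) 1, ((deriv φ x : ℝ) : ℂ) * u.fst j x
        = -∫ x in Ioo (0 : ℝ) 1, ((φ x : ℝ) : ℂ) * u.snd j x} := by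
    ext u
    simp only [IsWeakDeriv, HasWeakDeriv, mem_ofPred_eq, mem_iInter, Complex.real_smul]
  rw [e]
  refine isClosed_iInter fun j => isClosed_iInter fun φ => isClosed_iInter fun hφ => ?_
  have c1 : Continuous fun x => ((deriv φ x : ℝ) : ℂ) :=
    Complex.continuous_ofReal.comp hφ.deriv.1.continuous
  have c2 : Continuous fun x => ((φ x : ℝ) : ℂ) := Complex.continuous_ofReal.comp hφ.1.continuous
  exact isClosed_eq ((continuous_integral_mul c1 j).comp (WithLp.fstL 2 ℂ N.X2 N.X2).continuous)
    ((continuous_integral_mul c2 j).comp (WithLp.sndL 2 ℂ N.X2 N.X2).continuous).neg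

/-- The value at `e_j(0)` as a function of `(f, f')`. -/
def traceZero (u : WithLp 2 (N.X2 × N.X2)) (j : Fin m) : ℂ :=
  (∫ x in Ioo (0 : ℝ) 1, 1 * u.fst j x) - ∫ x in Ioo (0 : ℝ) 1, (1 + -1 * (x : ℂ)) * u.snd j x

/-- The value at `e_j(1)` as a function of `(f, f')`. -/
def traceOne (u : WithLp 2 (N.X2 × N.X2)) (j : Fin m) : ℂ :=
  (∫ x in Ioo (0 : ℝ) 1, 1 * u.fst j x) + ∫ x in Ioo (0 : ℝ) 1, (0 + 1 * (x : ℂ)) * u.snd j x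

theorem continuous_traceZero : Continuous (traceZero (N := N)) := by
  refine continuous_pi fun j => ?_
  exact ((continuous_integral_mul continuous_const j).comp
    (WithLp.fstL 2 ℂ N.X2 N.X2).continuous).sub
    ((continuous_integral_mul (by fun_prop) j).comp (WithLp.sndL 2 ℂ N.X2 N.X2).continuous)

theorem continuous_traceOne : Continuous (traceOne (N := N)) := by
  refine continuous_pi fun j => ?_
  exact ((continuous_integral_mul continuous_const j).comp
    (WithLp.fstL 2 ℂ N.X2 N.X2).continuous).add
    ((continuous_integral_mul (by fun_prop) j).comp (WithLp.sndL 2 ℂ N.X2 N.X2).continuous)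

theorem traceZero_eq {u : WithLp 2 (N.X2 × N.X2)} (hu : IsWeakDeriv u.fst u.snd) {j : Fin m}
    {F : ℝ → ℂ} (hF : IsContRep F (u.fst j)) : traceZero u j = F 0 := by
  rw [(hu j).apply_zero_eq hF (integrableOn_X2 u.snd j), traceZero]
  simp only [one_mul]

theorem traceOne_eq {u : WithLp 2 (N.X2 × N.X2)} (hu : IsWeakDeriv u.fst u.snd) {j : Fin m}
    {F : ℝ → ℂ} (hF : IsContRep F (u.fst j)) : traceOne u j = F 1 := by
  rw [(hu j).apply_one_eq hF (integrableOn_X2 u.snd j), traceOne]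
  simp only [one_mul]

variable (N) in
/-- The pairs of boundary values of functions that are continuous at the vertices. -/
def vertexValues : Submodule ℂ ((Fin m → ℂ) × (Fin m → ℂ)) :=
  LinearMap.range ((Matrix.mulVecLin (N.incPlus)ᵀ).prod (Matrix.mulVecLin (N.incMinus)ᵀ))

theorem isVertexContinuous_iff {u : WithLp 2 (N.X2 × N.X2)} (hu : IsWeakDeriv u.fst u.snd) :
    IsVertexContinuous u.fst ↔ (traceZero u, traceOne u) ∈ N.vertexValues := by
  constructor
  · rintro ⟨F, hF, d, h0, h1⟩
    refine ⟨d, Prod.ext ?_ ?_⟩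
    · exact h0.trans (funext fun j => (traceZero_eq hu (hF j)).symm)
    · exact h1.trans (funext fun j => (traceOne_eq hu (hF j)).symm)
  · rintro ⟨d, hd⟩
    choose F hF using fun j => (hu j).exists_isContRep (integrableOn_X2 u.fst j)
      (integrableOn_X2 u.snd j)
    refine ⟨F, hF, d, ?_, ?_⟩
    · exact (congrArg Prod.fst hd).trans (funext fun j => traceZero_eq hu (hF j))
    · exact (congrArg Prod.snd hd).trans (funext fun j => traceOne_eq hu (hF j))

/-- `V` is cut out of the closed graph of the weak derivative by a condition on the boundary values,
which depend continuously on the function; they are to lie in a finite-dimensional subspace. -/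
theorem isClosed_V : IsClosed (N.V : Set (WithLp 2 (N.X2 × N.X2))) := by
  have e : (N.V : Set (WithLp 2 (N.X2 × N.X2))) = {u | IsWeakDeriv u.fst u.snd}
      ∩ (fun u => (traceZero u, traceOne u)) ⁻¹' (N.vertexValues : Set _) := by
    ext u
    exact and_congr_right fun hu => isVertexContinuous_iff hu
  rw [e]
  exact isClosed_isWeakDeriv.inter ((Submodule.closed_of_finiteDimensional _).preimage
    (continuous_traceZero.prodMk continuous_traceOne))

instance : CompleteSpace N.V := isClosed_V.completeSpace_coe

/-! ### Elements of the form domain given by functions on the edges -/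

/-- Every family of square integrable functions on the edges is an element of `X₂`. -/
theorem exists_X2 {F : Fin m → ℝ → ℂ} (hF : ∀ j, MemLp (F j) 2 (volume.restrict (Ioo (0 : ℝ) 1))) :
    ∃ f : N.X2, ∀ j, f j =ᵐ[volume.restrict (Ioo (0 : ℝ) 1)] F j :=
  ⟨WithLp.toLp 2 fun j => (N.memLp_edge_iff.2 (hF j)).toLp (F j),
    fun j => N.ae_edge (N.memLp_edge_iff.2 (hF j)).coeFn_toLp⟩

theorem ext_X2 {f g : N.X2} (h : ∀ j, f j =ᵐ[volume.restrict (Ioo (0 : ℝ) 1)] g j) : f = g := by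
  ext j : 1
  apply Lp.ext
  exact (Measure.ae_ennreal_smul_measure_iff (N.ofReal_μ_ne_zero j)).2 (h j)

theorem incPlus_transpose_mulVec (d : Fin n → ℂ) : (N.incPlus)ᵀ *ᵥ d = fun j => d (N.src j) := by
  ext j
  simp [Matrix.mulVec, dotProduct, incPlus]

theorem incMinus_transpose_mulVec (d : Fin n → ℂ) : (N.incMinus)ᵀ *ᵥ d = fun j => d (N.tgt j) := by
  ext j
  simp [Matrix.mulVec, dotProduct, incMinus]

theorem memLp_of_continuous {F : ℝ → ℂ} (hF : Continuous F) :
    MemLp F 2 (volume.restrict (Ioo (0 : ℝ) 1)) := by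
  obtain ⟨K, hK⟩ := (isCompact_Icc (a := (0 : ℝ)) (b := 1)).exists_bound_of_continuousOn
    hF.continuousOn
  refine MemLp.of_bound hF.aestronglyMeasurable K ?_
  filter_upwards [ae_restrict_mem measurableSet_Ioo] with x hx
  exact hK x (Ioo_subset_Icc_self hx)

/-- Continuously differentiable functions on the edges that fit together at the vertices belong
to `V`. -/
theorem exists_mem_V {F F' : Fin m → ℝ → ℂ} (hF : ∀ j, Continuous (F j))
    (hF' : ∀ j, Continuous (F' j)) (hw : ∀ j, HasWeakDeriv (F j) (F' j)) (d : Fin n → ℂ)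
    (h0 : ∀ j, F j 0 = d (N.src j)) (h1 : ∀ j, F j 1 = d (N.tgt j)) :
    ∃ u : N.V, (∀ j, N.incl u j =ᵐ[volume.restrict (Ioo (0 : ℝ) 1)] F j) ∧
      ∀ j, N.derivV u j =ᵐ[volume.restrict (Ioo (0 : ℝ) 1)] F' j := by
  obtain ⟨f, hf⟩ := exists_X2 (N := N) fun j => memLp_of_continuous (hF j)
  obtain ⟨f', hf'⟩ := exists_X2 (N := N) fun j => memLp_of_continuous (hF' j)
  refine ⟨⟨WithLp.toLp 2 (f, f'), fun j => (hw j).congr (hf j).symm (hf' j).symm,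
    F, fun j => ⟨(hF j).continuousOn, hf j⟩, d, ?_, ?_⟩, hf, hf'⟩
  · rw [incPlus_transpose_mulVec]
    exact funext fun j => (h0 j).symm
  · rw [incMinus_transpose_mulVec]
    exact funext fun j => (h1 j).symm

/-- A test function on one edge, extended by zero, belongs to `V`. -/
theorem exists_mem_V_of_test {φ : ℝ → ℝ} (hφ : IsTestFunction φ) (i : Fin m) :
    ∃ u : N.V, (∀ j, N.incl u j =ᵐ[volume.restrict (Ioo (0 : ℝ) 1)]
        fun x => if j = i then ((φ x : ℝ) : ℂ) else 0) ∧
      ∀ j, N.derivV u j =ᵐ[volume.restrict (Ioo (0 : ℝ) 1)]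
        fun x => if j = i then ((deriv φ x : ℝ) : ℂ) else 0 := by
  have z0 : φ 0 = 0 := image_eq_zero_of_notMem_tsupport fun h => by simpa using hφ.2.2 h
  have z1 : φ 1 = 0 := image_eq_zero_of_notMem_tsupport fun h => by simpa using hφ.2.2 h
  have c1 := Complex.continuous_ofReal.comp hφ.1.continuous
  have c2 := Complex.continuous_ofReal.comp hφ.deriv.1.continuous
  refine exists_mem_V (fun j => ?_) (fun j => ?_) (fun j => ?_) 0 (fun j => ?_) fun j => ?_
  · split_ifs
    exacts [c1, continuous_const]
  · split_ifs
    exacts [c2, continuous_const]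
  · split_ifs
    exacts [hasWeakDeriv_ofReal (hφ.1.of_le (by simp)), hasWeakDeriv_zero]
  · simp [z0]
  · simp [z1]

theorem inner_eq_of_ae_ite {f g : N.X2} {φ : ℝ → ℝ} {i : Fin m}
    (hf : ∀ j, f j =ᵐ[volume.restrict (Ioo (0 : ℝ) 1)]
      fun x => if j = i then ((φ x : ℝ) : ℂ) else 0) :
    (inner ℂ f g : ℂ) = (N.μ i : ℂ) * ∫ x in Ioo (0 : ℝ) 1, φ x • g i x := by
  rw [inner_X2, Finset.sum_eq_single i]
  · congr 1
    refine integral_congr_ae ?_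
    filter_upwards [hf i] with x hx
    rw [hx, if_pos rfl, Complex.conj_ofReal, Complex.real_smul, mul_comm]
  · intro j _ hj
    have e : ∫ x in Ioo (0 : ℝ) 1, g j x * conj (f j x) = ∫ x in Ioo (0 : ℝ) 1, (0 : ℂ) := by
      refine integral_congr_ae ?_
      filter_upwards [hf j] with x hx
      rw [hx, if_neg hj, map_zero, mul_zero]
    rw [e, integral_zero, mul_zero]
  · simp

/-- A function orthogonal to `V` is orthogonal to all test functions on every edge. -/
theorem denseRange_incl : DenseRange N.incl := by
  have h : N.incl.range.topologicalClosure = ⊤ := by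
    rw [Submodule.topologicalClosure_eq_top_iff, Submodule.eq_bot_iff]
    intro g hg
    refine ext_X2 fun i => ?_
    have h1 := ae_eq_zero_of_test (integrableOn_X2 g i) fun φ hφ => by
      obtain ⟨u, hu, -⟩ := exists_mem_V_of_test (N := N) hφ i
      have h2 : (inner ℂ (N.incl u) g : ℂ) = 0 := hg _ ⟨u, rfl⟩
      rw [inner_eq_of_ae_ite hu] at h2
      exact (mul_eq_zero.1 h2).resolve_left (Complex.ofReal_ne_zero.2 (N.μ_pos i).ne')
    exact h1.trans (coeFn_zero_X2 i).symm
  exact Submodule.dense_iff_topologicalClosure_eq_top.2 h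

theorem incl_injective : Function.Injective N.incl := by
  intro u v h
  have h1 : u.1.fst = v.1.fst := h
  have h2 : u.1.snd = v.1.snd := by
    have hv := v.2.1
    rw [← h1] at hv
    exact u.2.1.unique hv
  exact Subtype.ext (WithLp.ofLp_injective 2 (Prod.ext h1 h2))

theorem norm_sq_V (u : N.V) : ‖u‖ ^ 2 = ‖N.incl u‖ ^ 2 + ‖N.derivV u‖ ^ 2 :=
  WithLp.prod_norm_sq_eq_of_L2 u.1

/-! ### The form and its norm -/

variable (N) in
theorem exists_c_bounds : ∃ k > 0, ∃ K > 0, ∀ j, ∀ x ∈ Icc (0 : ℝ) 1,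
    k ≤ N.c j x ∧ N.c j x ≤ K := by
  have h1 : ∀ j, ∃ K, ∀ x ∈ Icc (0 : ℝ) 1, ‖N.c j x‖ ≤ K := fun j =>
    isCompact_Icc.exists_bound_of_continuousOn (N.c_continuousOn j)
  have h2 : ∀ j, ∃ K, ∀ x ∈ Icc (0 : ℝ) 1, ‖(N.c j x)⁻¹‖ ≤ K := fun j =>
    isCompact_Icc.exists_bound_of_continuousOn
      ((N.c_continuousOn j).inv₀ fun x hx => (N.c_pos j x hx).ne')
  choose K hK using h1
  choose L hL using h2
  have le : ∀ (K : Fin m → ℝ), (∀ j, 0 ≤ K j) → ∀ j, K j ≤ ∑ i, K i + 1 := fun K hK j =>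
    (Finset.single_le_sum (fun i _ => hK i) (Finset.mem_univ j)).trans (by linarith)
  have h0 : (0 : ℝ) ∈ Icc (0 : ℝ) 1 := by simp
  have K0 : ∀ j, 0 ≤ K j := fun j => (norm_nonneg _).trans (hK j 0 h0)
  have L0 : ∀ j, 0 ≤ L j := fun j => (norm_nonneg _).trans (hL j 0 h0)
  have KS : 0 < ∑ i, K i + 1 := add_pos_of_nonneg_of_pos (Finset.sum_nonneg fun i _ => K0 i) one_pos
  have LS : 0 < ∑ i, L i + 1 := add_pos_of_nonneg_of_pos (Finset.sum_nonneg fun i _ => L0 i) one_pos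
  refine ⟨(∑ i, L i + 1)⁻¹, inv_pos.2 LS, ∑ i, K i + 1, KS, fun j x hx => ⟨?_, ?_⟩⟩
  · have := (le_abs_self _).trans ((hL j x hx).trans (le L L0 j))
    exact (inv_le_comm₀ (N.c_pos j x hx) LS).1 this
  · exact (le_abs_self _).trans ((hK j x hx).trans (le K K0 j))

/-- Multiplication by the coefficients, `f ↦ (c_j f_j)_j`. -/
theorem exists_mulC (f : N.X2) : ∃ g : N.X2,
    ∀ j, g j =ᵐ[volume.restrict (Ioo (0 : ℝ) 1)] fun x => (N.c j x : ℂ) * f j x :=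
  exists_X2 fun j => memLp_c_mul f j

/-- The form is `(c u', v')`; thus its algebraic properties are those of the inner product. -/
theorem form_eq_inner {u v : N.V} {g : N.X2}
    (hg : ∀ j, g j =ᵐ[volume.restrict (Ioo (0 : ℝ) 1)] fun x => (N.c j x : ℂ) * N.derivV u j x) :
    N.form u v = inner ℂ (N.derivV v) g := by
  rw [inner_X2, form]
  refine Finset.sum_congr rfl fun j _ => ?_
  rw [← integral_const_mul]
  refine integral_congr_ae ?_
  filter_upwards [hg j] with x hx
  rw [hx]
  ring

theorem form_re (u : N.V) : (N.form u u).re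
    = ∑ j, N.μ j * ∫ x in Ioo (0 : ℝ) 1, N.c j x * ‖N.derivV u j x‖ ^ 2 := by
  have e : N.form u u
      = ((∑ j, N.μ j * ∫ x in Ioo (0 : ℝ) 1, N.c j x * ‖N.derivV u j x‖ ^ 2 : ℝ) : ℂ) := by
    rw [form, Complex.ofReal_sum]
    refine Finset.sum_congr rfl fun j _ => ?_
    rw [Complex.ofReal_mul, ← integral_complex_ofReal, ← integral_const_mul]
    congr 1 with x
    rw [mul_assoc, Complex.mul_conj, Complex.normSq_eq_norm_sq]
    push_cast
    ring
  rw [e, Complex.ofReal_re]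

theorem integrable_norm_sq (f : N.X2) (j : Fin m) :
    IntegrableOn (fun x => ‖f j x‖ ^ 2) (Ioo (0 : ℝ) 1) :=
  (memLp_X2 f j).integrable_norm_pow two_ne_zero

theorem integrable_c_mul_norm_sq (f : N.X2) (j : Fin m) :
    IntegrableOn (fun x => N.c j x * ‖f j x‖ ^ 2) (Ioo (0 : ℝ) 1) := by
  obtain ⟨K, hK⟩ := isCompact_Icc.exists_bound_of_continuousOn (N.c_continuousOn j)
  refine (integrable_norm_sq f j).bdd_mul (c := K) (integrableOn_c j).1 ?_
  filter_upwards [ae_restrict_mem measurableSet_Ioo] with x hx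
  exact hK x (Ioo_subset_Icc_self hx)

section Bounds

variable {k K : ℝ} (hkK : ∀ j, ∀ x ∈ Icc (0 : ℝ) 1, k ≤ N.c j x ∧ N.c j x ≤ K)
include hkK

theorem form_bounds (u : N.V) :
    k * ‖N.derivV u‖ ^ 2 ≤ (N.form u u).re ∧ (N.form u u).re ≤ K * ‖N.derivV u‖ ^ 2 := by
  rw [form_re, norm_sq_X2, Finset.mul_sum, Finset.mul_sum]
  refine ⟨Finset.sum_le_sum fun j _ => ?_, Finset.sum_le_sum fun j _ => ?_⟩
  · rw [mul_left_comm, ← integral_const_mul]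
    refine mul_le_mul_of_nonneg_left (setIntegral_mono_on ((integrable_norm_sq _ j).const_mul k)
      (integrable_c_mul_norm_sq _ j) measurableSet_Ioo fun x hx => ?_) (N.μ_pos j).le
    exact mul_le_mul_of_nonneg_right (hkK j x (Ioo_subset_Icc_self hx)).1 (sq_nonneg _)
  · rw [mul_left_comm, ← integral_const_mul K]
    refine mul_le_mul_of_nonneg_left (setIntegral_mono_on (integrable_c_mul_norm_sq _ j)
      ((integrable_norm_sq _ j).const_mul K) measurableSet_Ioo fun x hx => ?_) (N.μ_pos j).le
    exact mul_le_mul_of_nonneg_right (hkK j x (Ioo_subset_Icc_self hx)).2 (sq_nonneg _)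

theorem norm_form_le (hK : 0 < K) (u v : N.V) :
    ‖N.form u v‖ ≤ K * ‖N.derivV u‖ * ‖N.derivV v‖ := by
  obtain ⟨g, hg⟩ := exists_mulC (N.derivV u)
  have h1 : ‖g‖ ^ 2 ≤ (K * ‖N.derivV u‖) ^ 2 := by
    rw [mul_pow, norm_sq_X2, norm_sq_X2, Finset.mul_sum]
    refine Finset.sum_le_sum fun j _ => ?_
    rw [mul_left_comm, ← integral_const_mul (K ^ 2)]
    refine mul_le_mul_of_nonneg_left (integral_mono_ae (integrable_norm_sq g j)
      ((integrable_norm_sq _ j).const_mul (K ^ 2)) ?_) (N.μ_pos j).le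
    filter_upwards [hg j, ae_restrict_mem measurableSet_Ioo] with x hx hx2
    have hx3 := Ioo_subset_Icc_self hx2
    rw [hx, norm_mul, Complex.norm_real, Real.norm_of_nonneg (N.c_pos j x hx3).le, mul_pow]
    exact mul_le_mul_of_nonneg_right
      (pow_le_pow_left₀ (N.c_pos j x hx3).le (hkK j x hx3).2 2) (sq_nonneg _)
  rw [form_eq_inner hg]
  refine (norm_inner_le_norm _ _).trans ?_
  rw [mul_comm]
  exact mul_le_mul_of_nonneg_right (le_of_sq_le_sq h1 (by positivity)) (norm_nonneg _)

end Bounds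

theorem form_symm (u v : N.V) : N.form u v = conj (N.form v u) := by
  simp only [form]
  rw [map_sum]
  refine Finset.sum_congr rfl fun j _ => ?_
  rw [← integral_conj]
  congr 1 with x
  simp only [map_mul, Complex.conj_ofReal, Complex.conj_conj]
  ring

theorem form_add_left (u v w : N.V) : N.form (u + v) w = N.form u w + N.form v w := by
  obtain ⟨g, hg⟩ := exists_mulC (N.derivV u)
  obtain ⟨k, hk⟩ := exists_mulC (N.derivV v)
  rw [form_eq_inner hg, form_eq_inner hk, ← inner_add_right]
  refine form_eq_inner fun j => ?_
  filter_upwards [hg j, hk j, coeFn_add_X2 g k j, coeFn_add_X2 (N.derivV u) (N.derivV v) j]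
    with x h1 h2 h3 h4
  rw [h3, h1, h2, map_add, h4, mul_add]

theorem form_smul_left (z : ℂ) (u v : N.V) : N.form (z • u) v = z * N.form u v := by
  obtain ⟨g, hg⟩ := exists_mulC (N.derivV u)
  rw [form_eq_inner hg, ← inner_smul_right]
  refine form_eq_inner fun j => ?_
  filter_upwards [hg j, coeFn_smul_X2 z g j, coeFn_smul_X2 z (N.derivV u) j] with x h1 h2 h3
  rw [h2, h1, map_smul, h3]
  ring

variable (N) in
/-- The constants come from the bounds of the coefficients: `min k 1 ≤ 𝔞(u, u) + ‖u‖² ≤ max K 1` on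
the unit sphere of `V`, if `k ≤ c_j ≤ K`. -/
theorem exists_formNorm_equiv : ∃ k > 0, ∃ K > 0, ∀ u : N.V,
    k * ‖u‖ ≤ formNorm N.incl N.form u ∧ formNorm N.incl N.form u ≤ K * ‖u‖ := by
  obtain ⟨k, hk, K, hK, hkK⟩ := N.exists_c_bounds
  refine ⟨√(min k 1), Real.sqrt_pos.2 (lt_min hk one_pos), √(max K 1),
    Real.sqrt_pos.2 (lt_max_of_lt_left hK), fun u => ⟨?_, ?_⟩⟩
  · rw [formNorm]
    refine Real.le_sqrt_of_sq_le ?_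
    rw [mul_pow, Real.sq_sqrt (lt_min hk one_pos).le, norm_sq_V]
    have h1 := (form_bounds hkK u).1
    have h2 := mul_le_mul_of_nonneg_right (min_le_left k 1) (sq_nonneg ‖N.derivV u‖)
    have h3 := mul_le_mul_of_nonneg_right (min_le_right k 1) (sq_nonneg ‖N.incl u‖)
    linarith
  · rw [formNorm]
    refine Real.sqrt_le_iff.2 ⟨by positivity, ?_⟩
    rw [mul_pow, Real.sq_sqrt (lt_max_of_lt_left hK).le, norm_sq_V]
    have h1 := (form_bounds hkK u).2
    have h2 := mul_le_mul_of_nonneg_right (le_max_left K 1) (sq_nonneg ‖N.derivV u‖)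
    have h3 := mul_le_mul_of_nonneg_right (le_max_right K 1) (sq_nonneg ‖N.incl u‖)
    linarith

variable (N) in
/-- The form is closed because its norm is equivalent to that of the complete space `V`. -/
theorem isClosedSymmetricForm : IsClosedSymmetricForm N.incl N.form where
  injective := incl_injective
  dense := denseRange_incl
  add_left := form_add_left
  smul_left := form_smul_left
  symm := form_symm
  nonneg u := by
    obtain ⟨k, hk, K, -, hkK⟩ := N.exists_c_bounds
    exact (by positivity : 0 ≤ k * ‖N.derivV u‖ ^ 2).trans (form_bounds hkK u).1
  closed u hu := by
    obtain ⟨k, hk, K, hK, hkK⟩ := N.exists_formNorm_equiv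
    have hc : CauchySeq u := by
      rw [Metric.cauchySeq_iff]
      intro ε hε
      obtain ⟨p, hp⟩ := hu (k * ε) (by positivity)
      refine ⟨p, fun q hq r hr => ?_⟩
      rw [dist_eq_norm]
      exact lt_of_mul_lt_mul_left ((hkK _).1.trans_lt (hp q hq r hr)) hk.le
    obtain ⟨v, hv⟩ := cauchySeq_tendsto_of_complete hc
    refine ⟨v, ?_⟩
    have h1 := ((tendsto_iff_norm_sub_tendsto_zero.1 hv).const_mul K)
    rw [mul_zero] at h1
    exact squeeze_zero (fun p => Real.sqrt_nonneg _) (fun p => (hkK _).2) h1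
  continuous := by
    obtain ⟨k, hk, K, hK, hkK⟩ := N.exists_c_bounds
    obtain ⟨k', hk', K', -, hkK'⟩ := N.exists_formNorm_equiv
    have hd : ∀ u : N.V, ‖N.derivV u‖ ≤ k'⁻¹ * formNorm N.incl N.form u := fun u => by
      rw [inv_mul_eq_div, le_div_iff₀ hk', mul_comm]
      refine le_trans (mul_le_mul_of_nonneg_left ?_ hk'.le) (hkK' u).1
      refine le_of_sq_le_sq ?_ (norm_nonneg _)
      rw [norm_sq_V]
      exact le_add_of_nonneg_left (sq_nonneg _)
    refine ⟨K * (k'⁻¹ * k'⁻¹), by positivity, fun u v => (norm_form_le hkK hK u v).trans ?_⟩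
    calc K * ‖N.derivV u‖ * ‖N.derivV v‖
        ≤ K * (k'⁻¹ * formNorm N.incl N.form u) * (k'⁻¹ * formNorm N.incl N.form v) :=
          mul_le_mul (mul_le_mul_of_nonneg_left (hd u) hK.le) (hd v) (norm_nonneg _)
            (mul_nonneg hK.le ((norm_nonneg _).trans (hd u)))
      _ = _ := by ring

/-! ### The operator associated with the form -/

theorem IsContRep.c_mul {G f : ℝ → ℂ} (hG : IsContRep G f) (j : Fin m) :
    IsContRep (fun x => (N.c j x : ℂ) * G x) (fun x => (N.c j x : ℂ) * f x) :=
  ⟨(Complex.continuous_ofReal.comp_continuousOn (N.c_continuousOn j)).mul hG.1, by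
    filter_upwards [hG.2] with x hx; rw [hx]⟩

theorem isWeakDeriv_V (u : N.V) : IsWeakDeriv (N.incl u) (N.derivV u) := u.2.1

/-- Integration by parts in the form. -/
theorem form_eq_boundary_sub {u h : N.V} {p : N.X2} {G H : Fin m → ℝ → ℂ}
    (hp : ∀ j, HasWeakDeriv (fun x => (N.c j x : ℂ) * N.derivV u j x) (p j))
    (hG : ∀ j, IsContRep (G j) (N.derivV u j)) (hH : ∀ j, IsContRep (H j) (N.incl h j)) :
    N.form u h = (∑ j, (N.μ j : ℂ) * ((N.c j 1 : ℂ) * G j 1 * conj (H j 1)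
      - (N.c j 0 : ℂ) * G j 0 * conj (H j 0))) - inner ℂ (N.incl h) p := by
  rw [inner_X2, ← Finset.sum_sub_distrib, form]
  refine Finset.sum_congr rfl fun j _ => ?_
  have e := (hp j).integral_mul_conj (isWeakDeriv_V h j) (IsContRep.c_mul (hG j) j) (hH j)
    (integrableOn_X2 p j) (integrableOn_X2 (N.derivV h) j)
  rw [← mul_sub, ← e, ← integral_const_mul]
  congr 1 with x
  ring

/-- The boundary terms, sorted by vertices. -/
theorem sum_boundary_eq (G₀ G₁ : Fin m → ℂ) (d : Fin n → ℂ) :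
    ∑ j, (N.μ j : ℂ) * ((N.c j 1 : ℂ) * G₁ j * conj (d (N.tgt j))
      - (N.c j 0 : ℂ) * G₀ j * conj (d (N.src j)))
    = ∑ i, conj (d i) * ((N.wincMinus *ᵥ G₁) i - (N.wincPlus *ᵥ G₀) i) := by
  simp only [Matrix.mulVec, dotProduct, wincMinus, wincPlus, Matrix.of_apply,
    ← Finset.sum_sub_distrib, Finset.mul_sum]
  rw [Finset.sum_comm]
  refine Finset.sum_congr rfl fun j _ => ?_
  simp only [mul_sub, ite_mul, zero_mul, mul_ite, mul_zero, Finset.sum_sub_distrib,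
    Finset.sum_ite_eq, Finset.mem_univ, if_true]
  push_cast
  ring

theorem V_boundary_values (h : N.V) : ∃ H : Fin m → ℝ → ℂ, (∀ j, IsContRep (H j) (N.incl h j)) ∧
    ∃ d : Fin n → ℂ, (∀ j, H j 0 = d (N.src j)) ∧ ∀ j, H j 1 = d (N.tgt j) := by
  obtain ⟨H, hH, d, h0, h1⟩ := h.2.2
  rw [incPlus_transpose_mulVec] at h0
  rw [incMinus_transpose_mulVec] at h1
  exact ⟨H, hH, d, fun j => (congrFun h0 j).symm, fun j => (congrFun h1 j).symm⟩

/-- Arbitrary values at the vertices are attained by functions in `V`: interpolate linearly. -/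
theorem exists_mem_V_of_values (d : Fin n → ℂ) : ∃ (h : N.V) (H : Fin m → ℝ → ℂ),
    (∀ j, IsContRep (H j) (N.incl h j)) ∧
      (∀ j, H j 0 = d (N.src j)) ∧ ∀ j, H j 1 = d (N.tgt j) := by
  have h0 : ∀ j, d (N.src j) + (d (N.tgt j) - d (N.src j)) * ((0 : ℝ) : ℂ) = d (N.src j) :=
    fun j => by simp
  have h1 : ∀ j, d (N.src j) + (d (N.tgt j) - d (N.src j)) * ((1 : ℝ) : ℂ) = d (N.tgt j) :=
    fun j => by simp
  have hc : ∀ j, Continuous fun x : ℝ => d (N.src j) + (d (N.tgt j) - d (N.src j)) * (x : ℂ) :=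
    fun j => by fun_prop
  obtain ⟨h, hh, -⟩ := exists_mem_V (N := N) hc (fun j => continuous_const)
    (fun j => hasWeakDeriv_affine _ _) d h0 h1
  exact ⟨h, _, fun j => ⟨(hc j).continuousOn, hh j⟩, h0, h1⟩

theorem coeFn_neg_X2 (g : N.X2) (j : Fin m) :
    ((-g) j : ℝ → ℂ) =ᵐ[volume.restrict (Ioo (0 : ℝ) 1)] fun x => -g j x :=
  N.ae_edge (Lp.coeFn_neg (g j))

/-- Testing with functions supported in the interior of one edge yields the differential
equation `(c_i u_i')' = -g_i`. -/
theorem hasWeakDeriv_of_form_eq {u : N.V} {g : N.X2}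
    (hu : ∀ h : N.V, N.form u h = inner ℂ (N.incl h) g) (i : Fin m) :
    HasWeakDeriv (fun x => (N.c i x : ℂ) * N.derivV u i x) ((-g) i) := by
  intro φ hφ
  obtain ⟨w, hw⟩ := exists_mulC (N.derivV u)
  obtain ⟨h, h1, h2⟩ := exists_mem_V_of_test (N := N) hφ i
  have e := hu h
  rw [form_eq_inner hw, inner_eq_of_ae_ite h1, inner_eq_of_ae_ite h2] at e
  have e1 := mul_left_cancel₀ (Complex.ofReal_ne_zero.2 (N.μ_pos i).ne') e
  have e2 : ∫ x in Ioo (0 : ℝ) 1, deriv φ x • ((N.c i x : ℂ) * N.derivV u i x)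
      = ∫ x in Ioo (0 : ℝ) 1, deriv φ x • w i x :=
    integral_congr_ae (by filter_upwards [hw i] with x hx; rw [hx])
  have e3 : ∫ x in Ioo (0 : ℝ) 1, φ x • (-g) i x = -∫ x in Ioo (0 : ℝ) 1, φ x • g i x := by
    rw [← integral_neg]
    exact integral_congr_ae (by filter_upwards [coeFn_neg_X2 g i] with x hx; rw [hx, smul_neg])
  rw [e2, e1, e3, neg_neg]

variable (N) in
/-- For `f ∈ D(A)` the boundary terms in the integration by parts vanish by the Kirchhoff law.
Conversely, test functions yield the differential equation, whence `f ∈ (H²(0,1))^m`, and the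
boundary terms that remain yield the Kirchhoff law. -/
theorem isAssociatedOperator : IsAssociatedOperator N.incl N.form N.A := by
  intro f g
  rw [A_graph_iff]
  constructor
  · rintro ⟨⟨f', f'', h1, h2, ⟨G, hG, hK⟩, h3⟩, ⟨k, k1, k2⟩⟩
    obtain rfl := h1.unique k1
    obtain ⟨u, rfl, rfl⟩ : ∃ u : N.V, N.incl u = f ∧ N.derivV u = f' :=
      ⟨⟨WithLp.toLp 2 (f, f'), h1, h3⟩, rfl, rfl⟩
    refine ⟨u, rfl, fun h => ?_⟩
    obtain ⟨H, hH, d, d0, d1⟩ := V_boundary_values h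
    rw [form_eq_boundary_sub (p := -g) k2 hG hH]
    simp only [d0, d1]
    rw [sum_boundary_eq (fun j => G j 0) (fun j => G j 1) d, hK]
    simp
  · rintro ⟨u, rfl, hu⟩
    have hw := hasWeakDeriv_of_form_eq hu
    have hex : ∀ j, ∃ q, MemLp q 2 (volume.restrict (Ioo (0 : ℝ) 1)) ∧
        HasWeakDeriv (N.derivV u j) q := fun j => by
      obtain ⟨c', hc', hcw⟩ := N.c_memH1 j
      exact hcw.exists_of_mul (N.c_continuousOn j) hc' (N.c_pos j) (memLp_X2 _ j)
        (memLp_X2 (-g) j) (hw j)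
    choose q hq hqw using hex
    obtain ⟨f'', hf''⟩ := exists_X2 (N := N) hq
    have h2 : IsWeakDeriv (N.derivV u) f'' := fun j => (hqw j).congr .rfl (hf'' j).symm
    choose G hG using fun j => (h2 j).exists_isContRep (integrableOn_X2 (N.derivV u) j)
      (integrableOn_X2 f'' j)
    refine ⟨⟨N.derivV u, f'', u.2.1, h2, ⟨G, hG, ?_⟩, u.2.2⟩, N.derivV u, u.2.1, hw⟩
    -- test with a function that equals one at the vertex `i` and zero at the others
    ext i
    obtain ⟨h, H, hH, d0, d1⟩ := exists_mem_V_of_values (N := N) (Pi.single i 1)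
    have e := hu h
    rw [form_eq_boundary_sub hw hG hH] at e
    simp only [d0, d1] at e
    rw [sum_boundary_eq (fun j => G j 0) (fun j => G j 1), Finset.sum_eq_single i
      (fun j _ hj => by simp [hj]) (by simp), inner_neg_right, sub_neg_eq_add,
      add_eq_right] at e
    rw [Pi.single_eq_same, map_one, one_mul] at e
    exact (sub_eq_zero.1 e).symm

end Network

end KirchhoffNetwork

end

theorem mainTheorem2 {n m : ℕ} (N : KirchhoffNetwork.Network n m) :
    KirchhoffNetwork.IsClosedSymmetricForm N.incl N.form ∧
    (∃ k > 0, ∃ K > 0, ∀ u : N.V,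
      k * ‖u‖ ≤ KirchhoffNetwork.formNorm N.incl N.form u ∧
      KirchhoffNetwork.formNorm N.incl N.form u ≤ K * ‖u‖) ∧
    KirchhoffNetwork.IsAssociatedOperator N.incl N.form N.A ∧
    IsSelfAdjoint N.A ∧
    KirchhoffNetwork.IsDissipative N.A ∧
    (∃ C : ℝ → N.X2 →L[ℂ] N.X2,
      KirchhoffNetwork.IsCosineFunction C ∧ KirchhoffNetwork.IsCosineGenerator N.A C) ∧
    KirchhoffNetwork.IsPhaseSpace N.incl N.A := by
  refine ⟨N.isClosedSymmetricForm, N.exists_formNorm_equiv, N.isAssociatedOperator, ?_⟩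
  obtain ⟨k, hk, K, hK, h⟩ := N.exists_formNorm_equiv
  -- The bounds are passed one at a time: checking the whole existential statement against the
  -- abstract one makes the unifier unfold the norm of `N.V`.
  have key := @KirchhoffNetwork.IsAssociatedOperator.generation N.X2 N.V _ _ _ _ N.incl N.form _ _
    N.isClosedSymmetricForm
  exact @key ⟨k, hk, K, hK, fun u => ⟨(h u).1, (h u).2⟩⟩ N.A N.isAssociatedOperator
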